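/- Let $k$ be a field of characteristic $0$. Let $\mathrm{Ass}_n$ be the algebra of formal power series in noncommuting variables $x_1,\dots,x_n$ over $k$, and $\mathfrak{lie}_n\subset \mathrm{Ass}_n$ the completed free Lie algebra (series all of whose homogeneous components are Lie polynomials); for $n=2,3$ write $x,y,z$ for the variables. Put $\mathrm{ch}(x,y)=\ln(e^xe^y)$. Let $\mathfrak{tr}_n=\mathrm{Ass}_n^+/\langle ab-ba\rangle$, where $\mathrm{Ass}_n^+$ is the space of series without constant term, with projection $\mathrm{Tr}:\mathrm{Ass}_n\to\mathfrak{tr}_n$ (zero on constants). Define $\delta:\mathfrak{tr}_2\to\mathfrak{tr}_3$ and $\tilde\delta:\mathfrak{tr}_1\to\mathfrak{tr}_2$ by $(\delta f)(x,y,z)=f(y,z)-f(x+y,z)+f(x,y+z)-f(x,y)$ and $(\tilde\delta f)(x,y)=f(y)-f(\mathrm{ch}(x,y))+f(x)$. Let $\mathfrak{der}^t_n$ be the set of tuples $u=(a_1,\dots,a_n)$ with $a_i\in\mathfrak{lie}_n$ such that the coefficient of $x_i$ in $a_i$ is $0$. Such a $u$ acts on $\mathrm{Ass}_n$ as the continuous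 derivation with $u(x_i)=[x_i,a_i]$, and on $\mathfrak{tr}_n$ by $u\cdot\mathrm{Tr}(a)=\mathrm{Tr}(u(a))$. The group $\mathrm{Dert}_n$ consists of the automorphisms $\exp(u)=\sum_{m\ge0}u^m/m!$, $u\in\mathfrak{der}^t_n$, with composition as product. Writing $a=a_0+\sum_i(\partial_i a)x_i$ for $a\in\mathrm{Ass}_n$, put $\mathrm{div}(u)=\sum_i\mathrm{Tr}(x_i\,\partial_i a_i)$ and $j(\exp u)=\frac{e^u-1}{u}\cdot\mathrm{div}(u)=\sum_{m\ge 0}\frac{1}{(m+1)!}\,u^m\cdot \mathrm{div}(u)$. Let $\mathrm{Sol}(\widehat{KV})$ be the set of $F\in\mathrm{Dert}_2$ with $F(x+y)=\mathrm{ch}(x,y)$ and $j(F)\in\mathrm{im}(\tilde\delta)$. Let $\widehat{\mathfrak{kv}}_2$ be the set of $u\in\mathfrak{der}^t_2$ with $u(x+y)=0$ and $\mathrm{div}(u)\in\ker(\delta)$, and $\widehat{KV}_2=\exp(\widehat{\mathfrak{kv}}_2)$. Let $t=(y,x)$. For $u=(a,b)\in\mathfrak{der}^t_2$ put $$u^{1,2}=(a(x,y),b(x,y),0),\qquad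 u^{2,3}=(0,a(y,z),b(y,z)),$$ $$u^{12,3}=(a(x+y,z),a(x+y,z),b(x+y,z)),\qquad u^{1,23}=(a(x,y+z),b(x,y+z),b(x,y+z)),$$ and for $F=\exp(u)$ put $F^{1,2}=\exp(u^{1,2})$, and so on. The solution of the pentagon equation attached to $F\in\mathrm{Sol}(\widehat{KV})$ is $$\Phi_F=(F^{12,3})^{-1}(F^{1,2})^{-1}F^{2,3}F^{1,23}.$$ **Proposition.** (1) Let $F_1,F_2\in\mathrm{Sol}(\widehat{KV})$. Then $\Phi_{F_1}=\Phi_{F_2}$ if and only if $F_2=F_1\exp(\lambda t)$ for some $\lambda\in k$. (2) For every $\lambda\in k$ one has $\lambda t\in\widehat{\mathfrak{kv}}_2$, and $\exp(\lambda t)$ commutes with every element of $\widehat{KV}_2$. Thus the decomposition of a pentagon solution is unique exactly up to the central one-parameter subgroup generated by $t$. -/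

import Mathlib

/-! ### The algebra `Ass_n` of formal power series in noncommuting variables -/

/-- `Ass_n`, the degree completion of the free associative algebra on `x_1, …, x_n`: a series is
the family of its coefficients, indexed by the words in the letters `Fin n`. -/
def Ass (k : Type*) (n : ℕ) : Type _ := List (Fin n) → k

namespace Ass

section Basic

variable {k : Type*} [Field k] {n m : ℕ}

noncomputable instance : AddCommGroup (Ass k n) := inferInstanceAs (AddCommGroup (List (Fin n) → k))

noncomputable instance : Module k (Ass k n) := inferInstanceAs (Module k (List (Fin n) → k))

@[ext] theorem ext {k : Type*} {a b : Ass k n} (h : ∀ w, a w = b w) : a = b := funext h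

@[simp] theorem zero_apply (w : List (Fin n)) : (0 : Ass k n) w = 0 := rfl

@[simp] theorem add_apply (a b : Ass k n) (w : List (Fin n)) : (a + b) w = a w + b w := rfl

@[simp] theorem sub_apply (a b : Ass k n) (w : List (Fin n)) : (a - b) w = a w - b w := rfl

@[simp] theorem neg_apply (a : Ass k n) (w : List (Fin n)) : (-a) w = -a w := rfl

@[simp] theorem smul_apply (c : k) (a : Ass k n) (w : List (Fin n)) : (c • a) w = c * a w := rfl

theorem sum_apply {ι : Type*} (s : Finset ι) (f : ι → Ass k n) (w : List (Fin n)) :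
    (∑ i ∈ s, f i) w = ∑ i ∈ s, f i w := Finset.sum_apply w s f

/-- The word `w`, as a monomial of `Ass_n`. -/
noncomputable def word (w : List (Fin n)) : Ass k n := fun v => if v = w then 1 else 0

/-- The generator `x_i`. -/
noncomputable def x (i : Fin n) : Ass k n := word [i]

noncomputable instance : One (Ass k n) := ⟨word []⟩

/-- Concatenation product: the coefficient of `w` in `a * b` is the sum over all the ways to cut
`w` into a prefix and a suffix. -/
noncomputable instance : Mul (Ass k n) :=
  ⟨fun a b w => ∑ i ∈ Finset.range (w.length + 1), a (w.take i) * b (w.drop i)⟩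

theorem mul_apply (a b : Ass k n) (w : List (Fin n)) :
    (a * b) w = ∑ i ∈ Finset.range (w.length + 1), a (w.take i) * b (w.drop i) := rfl

theorem one_apply (w : List (Fin n)) : (1 : Ass k n) w = if w = [] then 1 else 0 := rfl

/-- The series of the coefficients of the words that begin with `i`. -/
def shift (i : Fin n) (a : Ass k n) : Ass k n := fun w => a (i :: w)

@[simp] theorem mul_nil (a b : Ass k n) : (a * b) [] = a [] * b [] := by
  simp [mul_apply]

theorem mul_cons (a b : Ass k n) (i : Fin n) (w : List (Fin n)) :
    (a * b) (i :: w) = a [] * b (i :: w) + (shift i a * b) w := by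
  rw [mul_apply, List.length_cons, Finset.sum_range_succ', add_comm]
  rfl

private theorem add_mul' (a b c : Ass k n) : (a + b) * c = a * c + b * c := by
  ext w; simp [mul_apply, add_mul, Finset.sum_add_distrib]

private theorem mul_add' (a b c : Ass k n) : a * (b + c) = a * b + a * c := by
  ext w; simp [mul_apply, mul_add, Finset.sum_add_distrib]

private theorem smul_mul' (r : k) (a b : Ass k n) : (r • a) * b = r • (a * b) := by
  ext w; simp [mul_apply, mul_assoc, Finset.mul_sum]

private theorem mul_smul' (r : k) (a b : Ass k n) : a * (r • b) = r • (a * b) := by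
  ext w; simp [mul_apply, mul_left_comm, Finset.mul_sum]

private theorem zero_mul' (a : Ass k n) : 0 * a = 0 := by
  ext w; simp [mul_apply]

private theorem mul_zero' (a : Ass k n) : a * 0 = 0 := by
  ext w; simp [mul_apply]

private theorem shift_one (i : Fin n) : shift i (1 : Ass k n) = 0 := by
  ext w; simp [shift, one_apply]

private theorem one_mul' (a : Ass k n) : 1 * a = a := by
  ext w
  cases w with
  | nil => simp [one_apply]
  | cons i w => rw [mul_cons, shift_one, zero_mul']; simp [one_apply]

private theorem mul_one' (a : Ass k n) : a * 1 = a := by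
  ext w
  induction w generalizing a with
  | nil => simp [one_apply]
  | cons i w ih => rw [mul_cons, ih]; simp [one_apply, shift]

private theorem shift_mul (i : Fin n) (a b : Ass k n) :
    shift i (a * b) = a [] • shift i b + shift i a * b := by
  ext w; exact mul_cons a b i w

private theorem mul_assoc' (a b c : Ass k n) : a * b * c = a * (b * c) := by
  ext w
  induction w generalizing a with
  | nil => simp [mul_assoc]
  | cons i w ih =>
    rw [mul_cons, mul_cons a, mul_cons b, shift_mul, add_mul', add_apply, ih, smul_mul', mul_nil,
      smul_apply]
    ring

noncomputable instance : Ring (Ass k n) :=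
  { (inferInstance : AddCommGroup (Ass k n)) with
    mul := (· * ·)
    one := 1
    zero_mul := zero_mul'
    mul_zero := mul_zero'
    one_mul := one_mul'
    mul_one := mul_one'
    left_distrib := mul_add'
    right_distrib := add_mul'
    mul_assoc := mul_assoc' }

noncomputable instance : Algebra k (Ass k n) := Algebra.ofModule smul_mul' mul_smul'

/-- The finite set of all words of length at most `N`. -/
noncomputable def words (n N : ℕ) : Finset (List (Fin n)) :=
  (List.finite_length_le (Fin n) N).toFinset

@[simp] theorem mem_words {N : ℕ} {w : List (Fin n)} : w ∈ words n N ↔ w.length ≤ N := by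
  simp [words]

/-- `f = ∑_w f_w w ↦ ∑_w f_w φ(w)`, the continuous linear extension of a map `φ` on words that
does not lower degrees (`φ(w)` has no terms of degree less than the length of `w`); for such `φ`
only words of length at most that of `v` contribute to the coefficient of `v`. -/
noncomputable def extend (φ : List (Fin n) → Ass k m) : Ass k n →ₗ[k] Ass k m where
  toFun f := fun v => ∑ w ∈ words n v.length, f w * φ w v
  map_add' f g := funext fun v => by
    change _ = (∑ w ∈ words n v.length, f w * φ w v) + ∑ w ∈ words n v.length, g w * φ w v
    simp [add_mul, Finset.sum_add_distrib]
  map_smul' c f := funext fun v => by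
    change _ = c * ∑ w ∈ words n v.length, f w * φ w v
    simp [mul_assoc, Finset.mul_sum]

theorem extend_apply (φ : List (Fin n) → Ass k m) (f : Ass k n) (v : List (Fin m)) :
    extend φ f v = ∑ w ∈ words n v.length, f w * φ w v := rfl

/-- `a` has no terms of degree less than `d`. -/
def OrderGE (d : ℕ) (a : Ass k n) : Prop := ∀ w : List (Fin n), w.length < d → a w = 0

theorem OrderGE.mono {d e : ℕ} {a : Ass k n} (h : OrderGE d a) (hed : e ≤ d) : OrderGE e a :=
  fun w hw => h w (by omega)

theorem OrderGE.add {d : ℕ} {a b : Ass k n} (ha : OrderGE d a) (hb : OrderGE d b) :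
    OrderGE d (a + b) := fun w hw => by simp [ha w hw, hb w hw]

theorem OrderGE.mul {d e : ℕ} {a b : Ass k n} (ha : OrderGE d a) (hb : OrderGE e b) :
    OrderGE (d + e) (a * b) := by
  intro w hw
  rw [mul_apply]
  refine Finset.sum_eq_zero fun i hi => ?_
  rw [Finset.mem_range] at hi
  by_cases h : i < d
  · rw [ha _ (by rw [List.length_take]; omega), zero_mul]
  · rw [hb _ (by rw [List.length_drop]; omega), mul_zero]

theorem orderGE_word (w : List (Fin n)) : OrderGE w.length (word w : Ass k n) := by
  intro v hv
  have : v ≠ w := by rintro rfl; omega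
  simp [word, this]

/-! ### Substitution -/

/-- `f ↦ f(b_1, …, b_n)`, the substitution of series `b_i` without constant term for `x_i`. -/
noncomputable def subst (b : Fin n → Ass k m) : Ass k n →ₗ[k] Ass k m :=
  extend fun w => (w.map b).prod

theorem orderGE_prod {b : Fin n → Ass k m} (hb : ∀ i, b i [] = 0) (w : List (Fin n)) :
    OrderGE w.length (w.map b).prod := by
  induction w with
  | nil => intro v hv; simp at hv
  | cons i w ih =>
    rw [List.map_cons, List.prod_cons, List.length_cons, add_comm]
    refine OrderGE.mul (fun v hv => ?_) ih
    have : v = [] := by simpa using hv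
    rw [this, hb]

theorem subst_apply_of_le {b : Fin n → Ass k m} (hb : ∀ i, b i [] = 0) (f : Ass k n)
    (v : List (Fin m)) {N : ℕ} (hN : v.length ≤ N) :
    subst b f v = ∑ w ∈ words n N, f w * (w.map b).prod v := by
  rw [subst, extend_apply]
  refine Finset.sum_subset (fun w hw => ?_) (fun w _ hw => ?_)
  · rw [mem_words] at hw ⊢; omega
  · rw [mem_words, not_le] at hw
    rw [orderGE_prod hb w v hw, mul_zero]

theorem subst_one {b : Fin n → Ass k m} (hb : ∀ i, b i [] = 0) : subst b 1 = 1 := by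
  ext v
  rw [subst_apply_of_le hb 1 v le_rfl, Finset.sum_eq_single []]
  · simp [one_apply]
  · intro w _ hw; simp [one_apply, hw]
  · simp

theorem subst_mul {b : Fin n → Ass k m} (hb : ∀ i, b i [] = 0) (f g : Ass k n) :
    subst b (f * g) = subst b f * subst b g := by
  ext v
  set N := v.length with hNv
  have hr : (subst b f * subst b g) v = ∑ p ∈ words n N ×ˢ words n N,
      f p.1 * g p.2 * ((p.1 ++ p.2).map b).prod v := by
    rw [mul_apply, Finset.sum_congr rfl fun i hi => by
      rw [subst_apply_of_le hb f (v.take i) (N := N) (by rw [List.length_take]; omega),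
        subst_apply_of_le hb g (v.drop i) (N := N) (by rw [List.length_drop]; omega),
        Finset.sum_mul_sum, ← Finset.sum_product'], Finset.sum_comm]
    refine Finset.sum_congr rfl fun p _ => ?_
    rw [List.map_append, List.prod_append, mul_apply, Finset.mul_sum]
    exact Finset.sum_congr rfl fun i _ => by ring
  rw [hr, subst_apply_of_le hb (f * g) v (N := N + N) (by omega)]
  simp_rw [mul_apply, Finset.sum_mul]
  rw [Finset.sum_sigma']
  symm
  refine Finset.sum_of_injOn (fun p => ⟨p.1 ++ p.2, p.1.length⟩) ?_ ?_ ?_ ?_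
  · rintro ⟨p, q⟩ _ ⟨p', q'⟩ _ h
    simp only [Sigma.mk.injEq, heq_eq_eq] at h
    obtain ⟨h1, h2⟩ := List.append_inj h.1 h.2
    rw [h1, h2]
  · rintro ⟨p, q⟩ hp
    simp only [Finset.coe_product, Set.mem_prod, Finset.mem_coe, mem_words] at hp
    simp only [Finset.coe_sigma, Set.mem_sigma_iff, Finset.mem_coe, mem_words, Finset.mem_range,
      List.length_append]
    omega
  · rintro ⟨w, i⟩ hw hni
    simp only [Finset.mem_sigma, mem_words, Finset.mem_range] at hw
    have hlen : N < w.length := by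
      by_contra hle
      refine hni ⟨(w.take i, w.drop i), ?_, ?_⟩
      · simp only [Finset.coe_product, Set.mem_prod, Finset.mem_coe, mem_words, List.length_take,
          List.length_drop]
        omega
      · simp only [List.take_append_drop, List.length_take]
        congr 1
        omega
    rw [orderGE_prod hb w v hlen, mul_zero]
  · rintro ⟨p, q⟩ _
    simp

/-! ### Lie series -/

/-- The homogeneous component of degree `d`. -/
def component (d : ℕ) (a : Ass k n) : Ass k n := fun w => if w.length = d then a w else 0

noncomputable instance : LieRing (Ass k n) := LieRing.ofAssociativeRing

/-- Lie polynomials: the free Lie algebra on `x_1, …, x_n`, as the Lie subalgebra that the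
generators span in the free associative algebra (with bracket `[a, b] = ab - ba`). -/
noncomputable def liePoly (k : Type*) [Field k] (n : ℕ) : LieSubalgebra k (Ass k n) :=
  LieSubalgebra.lieSpan k (Ass k n) (Set.range x)

/-- `lie_n`, the degree completion of the free Lie algebra on `x_1, …, x_n`: the series all of
whose homogeneous components are Lie polynomials. -/
def lie (k : Type*) [Field k] (n : ℕ) : Set (Ass k n) :=
  {a | ∀ d, component d a ∈ liePoly k n}

/-! ### The Campbell–Hausdorff series -/

/-- `∑_j c_j a^j`, for a series `a` without constant term. -/
noncomputable def evalSeries (c : ℕ → k) (a : Ass k n) : Ass k n :=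
  fun w => ∑ j ∈ Finset.range (w.length + 1), c j * (a ^ j) w

/-- `e^a`, for `a` without constant term. -/
noncomputable def exp (a : Ass k n) : Ass k n := evalSeries (fun j => (j.factorial : k)⁻¹) a

/-- `ln b`, for `b` with constant term `1`: `ln (1 - a) = - ∑_{j ≥ 1} a^j / j`
(the term `j = 0` vanishes, since `0⁻¹ = 0`). -/
noncomputable def ln (b : Ass k n) : Ass k n := -evalSeries (fun j => (j : k)⁻¹) (1 - b)

/-- `ch(x, y) = ln (e^x e^y)`. -/
noncomputable def ch (k : Type*) [Field k] : Ass k 2 := ln (exp (x 0) * exp (x 1))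

theorem ch_nil : ch k [] = 0 := by
  simp [ch, ln, evalSeries]

theorem x_nil (i : Fin n) : (x i : Ass k n) [] = 0 := by
  simp [x, word]

/-! ### The space `tr_n` -/

/-- The span of the commutators `ab - ba` and of the constants. -/
noncomputable def trKer (k : Type*) [Field k] (n : ℕ) : Submodule k (Ass k n) :=
  Submodule.span k ({c | ∃ a b : Ass k n, c = a * b - b * a} ∪ {1})

/-- `tr_n = Ass_n^+ / ⟨ab - ba⟩`, written as the quotient of `Ass_n = k ⊕ Ass_n^+` by the
commutators and the constants, so that the trace is defined on all of `Ass_n`. -/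
abbrev Trace (k : Type*) [Field k] (n : ℕ) : Type _ := Ass k n ⧸ trKer k n

/-- The projection `Tr : Ass_n → tr_n`. -/
noncomputable def Tr : Ass k n →ₗ[k] Trace k n := (trKer k n).mkQ

/-- `f ↦ f(b_1, …, b_n)`, as a map `tr_n → tr_m`. -/
noncomputable def Trace.subst (b : Fin n → Ass k m) (hb : ∀ i, b i [] = 0) :
    Trace k n →ₗ[k] Trace k m :=
  (trKer k n).mapQ (trKer k m) (Ass.subst b) (by
    rw [trKer, Submodule.span_le]
    rintro _ (⟨a, c, rfl⟩ | rfl)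
    · refine Submodule.subset_span (Or.inl ⟨Ass.subst b a, Ass.subst b c, ?_⟩)
      rw [map_sub, subst_mul hb, subst_mul hb]
    · exact Submodule.subset_span (Or.inr (subst_one hb)))

/-- `δ : tr_2 → tr_3`, `(δf)(x, y, z) = f(y, z) - f(x + y, z) + f(x, y + z) - f(x, y)`. -/
noncomputable def delta (k : Type*) [Field k] : Trace k 2 →ₗ[k] Trace k 3 :=
  Trace.subst ![x 1, x 2] (by simp [Fin.forall_fin_two, x_nil])
    - Trace.subst ![x 0 + x 1, x 2] (by simp [Fin.forall_fin_two, x_nil])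
    + Trace.subst ![x 0, x 1 + x 2] (by simp [Fin.forall_fin_two, x_nil])
    - Trace.subst ![x 0, x 1] (by simp [Fin.forall_fin_two, x_nil])

/-- `δ̃ : tr_1 → tr_2`, `(δ̃f)(x, y) = f(y) - f(ch(x, y)) + f(x)`. -/
noncomputable def deltaTilde (k : Type*) [Field k] : Trace k 1 →ₗ[k] Trace k 2 :=
  Trace.subst ![x 1] (by simp [x_nil])
    - Trace.subst ![ch k] (by simp [ch_nil])
    + Trace.subst ![x 0] (by simp [x_nil])

/-! ### Tangential derivations -/

/-- `dert_n`: tuples `(a_1, …, a_n)` of Lie series such that the coefficient of `x_i` in `a_i`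
vanishes; such a tuple stands for the derivation with `x_i ↦ [x_i, a_i]`. -/
def dert (k : Type*) [Field k] (n : ℕ) : Set (Fin n → Ass k n) :=
  {u | ∀ i, u i ∈ lie k n ∧ u i [i] = 0}

/-- The value on a word of the derivation with `x_i ↦ [x_i, u_i]`, by the Leibniz rule. -/
noncomputable def derWord (u : Fin n → Ass k n) : List (Fin n) → Ass k n
  | [] => 0
  | i :: w => (x i * u i - u i * x i) * word w + x i * derWord u w

/-- The continuous derivation of `Ass_n` with `x_i ↦ [x_i, u_i]`. -/
noncomputable def der (u : Fin n → Ass k n) : Ass k n →ₗ[k] Ass k n := extend (derWord u)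

theorem orderGE_x (i : Fin n) : OrderGE 1 (x i : Ass k n) := orderGE_word [i]

theorem orderGE_bracket (i : Fin n) (a : Ass k n) : OrderGE 2 (x i * a - a * x i) := by
  have key : x i * a - a * x i = x i * (a - a [] • 1) - (a - a [] • 1) * x i := by
    rw [mul_sub, sub_mul, mul_smul_comm, smul_mul_assoc, mul_one, one_mul]; abel
  have h1 : OrderGE 1 (a - a [] • (1 : Ass k n)) := by
    intro w hw
    have : w = [] := by simpa using hw
    simp [this, one_apply]
  rw [key]
  intro w hw
  rw [sub_apply, (orderGE_x i).mul h1 w hw, h1.mul (orderGE_x i) w hw, sub_zero]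

theorem orderGE_derWord (u : Fin n → Ass k n) (w : List (Fin n)) :
    OrderGE (w.length + 1) (derWord u w) := by
  induction w with
  | nil => intro v _; rfl
  | cons i w ih =>
    refine OrderGE.add ?_ ?_
    · exact ((orderGE_bracket i (u i)).mul (orderGE_word w)).mono (by rw [List.length_cons]; omega)
    · exact ((orderGE_x i).mul ih).mono (by rw [List.length_cons]; omega)

theorem orderGE_der (u : Fin n → Ass k n) {d : ℕ} {f : Ass k n} (hf : OrderGE d f) :
    OrderGE (d + 1) (der u f) := by
  intro v hv
  rw [der, extend_apply]
  refine Finset.sum_eq_zero fun w _ => ?_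
  by_cases h : w.length < d
  · rw [hf w h, zero_mul]
  · rw [orderGE_derWord u w v (by omega), mul_zero]

theorem orderGE_der_pow (u : Fin n → Ass k n) {d : ℕ} {f : Ass k n} (hf : OrderGE d f) (j : ℕ) :
    OrderGE (d + j) ((der u ^ j) f) := by
  induction j with
  | zero => simpa using hf
  | succ j ih => rw [pow_succ', Module.End.mul_apply]; exact orderGE_der u ih

/-- `∑_j c_j u^j(f)` for a derivation `u`; the sum is finite in each degree, since `u` raises
degrees. -/
noncomputable def derSeries (c : ℕ → k) (u : Fin n → Ass k n) : Ass k n →ₗ[k] Ass k n where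
  toFun f := fun w => ∑ j ∈ Finset.range (w.length + 1), c j * (der u ^ j) f w
  map_add' f g := funext fun w => by
    change _ = (∑ j ∈ Finset.range (w.length + 1), c j * (der u ^ j) f w)
      + ∑ j ∈ Finset.range (w.length + 1), c j * (der u ^ j) g w
    simp [mul_add, Finset.sum_add_distrib]
  map_smul' r f := funext fun w => by
    change _ = r * ∑ j ∈ Finset.range (w.length + 1), c j * (der u ^ j) f w
    simp [mul_left_comm, Finset.mul_sum]

theorem derSeries_apply (c : ℕ → k) (u : Fin n → Ass k n) (f : Ass k n) (w : List (Fin n)) :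
    derSeries c u f w = ∑ j ∈ Finset.range (w.length + 1), c j * (der u ^ j) f w := rfl

theorem derSeries_eq (c : ℕ → k) (u : Fin n → Ass k n) (f : Ass k n) (w : List (Fin n)) {N : ℕ}
    (hN : w.length ≤ N) :
    derSeries c u f w = (∑ j ∈ Finset.range (N + 1), c j • (der u ^ j) f) w := by
  rw [sum_apply, derSeries_apply]
  refine Finset.sum_subset (fun j hj => ?_) (fun j _ hj => ?_)
  · rw [Finset.mem_range] at hj ⊢; omega
  · rw [Finset.mem_range, not_lt] at hj
    rw [orderGE_der_pow u (d := 0) (f := f) (fun v hv => by omega) j w (by omega), mul_zero]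

theorem derSeries_mul (b c : ℕ → k) (u : Fin n → Ass k n) (f : Ass k n) :
    derSeries b u (derSeries c u f) = derSeries
      (fun j => ∑ p ∈ Finset.HasAntidiagonal.antidiagonal j, b p.1 * c p.2) u f := by
  ext w
  set N := w.length with hN
  have h1 : ∀ i, (der u ^ i) (derSeries c u f) w
      = ∑ j ∈ Finset.range (N + 1), c j * (der u ^ (i + j)) f w := by
    intro i
    have h2 : OrderGE (N + 1) (derSeries c u f
        - ∑ j ∈ Finset.range (N + 1), c j • (der u ^ j) f) := by
      intro v hv
      rw [sub_apply, derSeries_eq c u f v (N := N) (by omega), sub_self]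
    have h3 := orderGE_der_pow u h2 i w (by omega)
    rw [map_sub, sub_apply, sub_eq_zero] at h3
    rw [h3, map_sum, sum_apply]
    refine Finset.sum_congr rfl fun j _ => ?_
    rw [map_smul, smul_apply, pow_add, Module.End.mul_apply]
  have h0 : ∀ j, N < j → (der u ^ j) f w = 0 := fun j hj =>
    orderGE_der_pow u (d := 0) (f := f) (fun v hv => by omega) j w (by omega)
  rw [derSeries_apply, derSeries_apply, ← hN]
  simp_rw [h1, Finset.mul_sum, Finset.sum_mul]
  rw [← Finset.sum_product', Finset.sum_sigma']
  symm
  refine Finset.sum_of_injOn (fun q => q.2) ?_ ?_ ?_ ?_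
  · rintro ⟨j, p⟩ h ⟨j', p'⟩ h' hp
    simp only [Finset.coe_sigma, Set.mem_sigma_iff, Finset.mem_coe, Finset.HasAntidiagonal.mem_antidiagonal]
      at h h'
    have hpp : p = p' := hp
    subst hpp
    have : j = j' := by omega
    subst this
    rfl
  · rintro ⟨j, p⟩ h
    simp only [Finset.coe_sigma, Set.mem_sigma_iff, Finset.mem_coe, Finset.HasAntidiagonal.mem_antidiagonal,
      Finset.mem_range] at h
    simp only [Finset.coe_product, Set.mem_prod, Finset.mem_coe, Finset.mem_range]
    omega
  · rintro ⟨i, j⟩ _ hni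
    have : N < i + j := by
      by_contra hle
      refine hni ⟨⟨i + j, (i, j)⟩, ?_, rfl⟩
      rw [Finset.mem_coe, Finset.mem_sigma]
      exact ⟨Finset.mem_range.2 (by change i + j < _; omega),
        Finset.HasAntidiagonal.mem_antidiagonal.2 rfl⟩
    simp only [h0 _ this, mul_zero]
  · rintro ⟨j, p⟩ h
    simp only [Finset.mem_sigma, Finset.HasAntidiagonal.mem_antidiagonal] at h
    simp only [← h.2]
    ring


theorem der_neg (u : Fin n → Ass k n) : der (-u) = -der u := by
  have hw : ∀ w, derWord (-u) w = -derWord u w := by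
    intro w
    induction w with
    | nil => simp [derWord]
    | cons i w ih => simp only [derWord, ih, Pi.neg_apply]; noncomm_ring
  refine LinearMap.ext fun f => ?_
  ext v
  simp [der, extend_apply, hw]

theorem derSeries_neg (c : ℕ → k) (u : Fin n → Ass k n) :
    derSeries c (-u) = derSeries (fun j => (-1) ^ j * c j) u := by
  refine LinearMap.ext fun f => ?_
  ext w
  rw [derSeries_apply, derSeries_apply]
  refine Finset.sum_congr rfl fun j _ => ?_
  have : (der (-u) ^ j) f = ((-1 : k) ^ j) • (der u ^ j) f := by
    rw [der_neg]
    have : -der u = (-1 : k) • der u := by simp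
    rw [this, smul_pow, LinearMap.smul_apply]
  rw [this, smul_apply]
  ring

end Basic

section Groups

variable {k : Type*} [Field k] [CharZero k] {n : ℕ}

theorem derSeries_exp_neg (u : Fin n → Ass k n) (f : Ass k n) :
    derSeries (fun j => (j.factorial : k)⁻¹) u
      (derSeries (fun j => (j.factorial : k)⁻¹) (-u) f) = f := by
  rw [derSeries_neg, derSeries_mul]
  have hc : ∀ j, ∑ p ∈ Finset.HasAntidiagonal.antidiagonal j,
      ((p.1.factorial : k)⁻¹ * ((-1) ^ p.2 * (p.2.factorial : k)⁻¹)) = if j = 0 then 1 else 0 := by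
    intro j
    have h := congrArg (PowerSeries.coeff j) (PowerSeries.exp_mul_exp_neg_eq_one (A := k))
    rw [PowerSeries.coeff_mul, PowerSeries.coeff_one] at h
    rw [← h]
    refine Finset.sum_congr rfl fun p _ => ?_
    simp [PowerSeries.evalNegHom, PowerSeries.coeff_rescale, PowerSeries.coeff_exp]
  ext w
  rw [derSeries_apply]
  simp_rw [hc]
  simp

/-- `exp(u) = ∑_j u^j / j!`, the automorphism of `Ass_n` (and of `lie_n ⊆ Ass_n`) attached to a
tangential derivation `u`; its inverse is `exp(-u)`. The group `Dert_n` consists of the `exp(u)`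
with `u ∈ dert_n`; its product is the composition of automorphisms. -/
noncomputable def expAut (u : Fin n → Ass k n) : Ass k n ≃ₗ[k] Ass k n :=
  LinearEquiv.ofLinearMap (derSeries (fun j => (j.factorial : k)⁻¹) u)
    (derSeries (fun j => (j.factorial : k)⁻¹) (-u))
    (LinearMap.ext (derSeries_exp_neg u))
    (LinearMap.ext fun f => by simpa using derSeries_exp_neg (-u) f)

/-! ### Divergence, the cocycle `j`, and the Kashiwara–Vergne problem -/

/-- `∂_i a`, from the decomposition `a = a_0 + ∑_i (∂_i a) x_i`. -/
def partialD (i : Fin n) (a : Ass k n) : Ass k n := fun w => a (w ++ [i])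

/-- `∑_i x_i (∂_i u_i) ∈ Ass_n`. -/
noncomputable def divAss (u : Fin n → Ass k n) : Ass k n := ∑ i, x i * partialD i (u i)

/-- The divergence `div(u) = ∑_i Tr(x_i (∂_i u_i))`. -/
noncomputable def div (u : Fin n → Ass k n) : Trace k n := Tr (divAss u)

/-- The group cocycle `j(exp(u)) = ((e^u - 1) / u) · div(u) = ∑_i u^i · div(u) / (i + 1)!`,
where `u` acts on `tr_n` by `u · Tr(a) = Tr(u(a))`. -/
noncomputable def cocycleJ (u : Fin n → Ass k n) : Trace k n :=
  Tr (derSeries (fun i => ((i + 1).factorial : k)⁻¹) u (divAss u))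

/-- `Sol(HKV)`: the solutions `F = exp(u)`, `u ∈ dert_2`, of the generalized Kashiwara–Vergne
problem `F(x + y) = ch(x, y)`, `j(F) ∈ im δ̃`. The element `F` is recorded by `u = ln F`. -/
def SolHKV (k : Type*) [Field k] [CharZero k] : Set (Fin 2 → Ass k 2) :=
  {u | u ∈ dert k 2 ∧ expAut u (x 0 + x 1) = ch k ∧ cocycleJ u ∈ LinearMap.range (deltaTilde k)}

/-- `hkv_2`: special derivations with divergence in the kernel of `δ`. The group `HKV_2` consists
of the `exp(u)` with `u ∈ hkv_2`. -/
def hkv (k : Type*) [Field k] [CharZero k] : Set (Fin 2 → Ass k 2) :=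
  {u | u ∈ dert k 2 ∧ der u (x 0 + x 1) = 0 ∧ div u ∈ LinearMap.ker (delta k)}

/-- `t = (y, x) ∈ dert_2`. -/
noncomputable def t (k : Type*) [Field k] : Fin 2 → Ass k 2 := ![x 1, x 0]

/-! ### Simplicial and coproduct maps `dert_2 → dert_3` -/

/-- `u^{1,2} = (a(x, y), b(x, y), 0)` for `u = (a, b)`. -/
noncomputable def map_1_2 (u : Fin 2 → Ass k 2) : Fin 3 → Ass k 3 :=
  ![subst ![x 0, x 1] (u 0), subst ![x 0, x 1] (u 1), 0]

/-- `u^{2,3} = (0, a(y, z), b(y, z))`. -/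
noncomputable def map_2_3 (u : Fin 2 → Ass k 2) : Fin 3 → Ass k 3 :=
  ![0, subst ![x 1, x 2] (u 0), subst ![x 1, x 2] (u 1)]

/-- `u^{12,3} = (a(x + y, z), a(x + y, z), b(x + y, z))`. -/
noncomputable def map_12_3 (u : Fin 2 → Ass k 2) : Fin 3 → Ass k 3 :=
  ![subst ![x 0 + x 1, x 2] (u 0), subst ![x 0 + x 1, x 2] (u 0), subst ![x 0 + x 1, x 2] (u 1)]

/-- `u^{1,23} = (a(x, y + z), b(x, y + z), b(x, y + z))`. -/
noncomputable def map_1_23 (u : Fin 2 → Ass k 2) : Fin 3 → Ass k 3 :=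
  ![subst ![x 0, x 1 + x 2] (u 0), subst ![x 0, x 1 + x 2] (u 1), subst ![x 0, x 1 + x 2] (u 1)]

/-- The solution `Φ = (F^{12,3})⁻¹ (F^{1,2})⁻¹ F^{2,3} F^{1,23}` of the pentagon equation attached
to `F = exp(u)`, where `F^{1,2} = exp(u^{1,2})` and so on. -/
noncomputable def pentagonSol (u : Fin 2 → Ass k 2) : Ass k 3 ≃ₗ[k] Ass k 3 :=
  (expAut (map_12_3 u))⁻¹ * (expAut (map_1_2 u))⁻¹ * expAut (map_2_3 u) * expAut (map_1_23 u)

end Groups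

end Ass

/-!
A tangential automorphism sends `x_i` to `c⁻¹ x_i c`, where the conjugator `c` is unique up to left
multiplication by series in `x_i` alone, so the coefficients of `c` on words without `x_i` are
determined. Write `Φ = Φ_F` as `F^{1,2} F^{12,3} Φ = F^{2,3} F^{1,23}`. Comparing conjugators at `x`
with `x = 0`, and at `z` with `z = 0`, shows that `F = exp(a, b)` has the conjugators
`F(exp(α (x + y)) d)` at `x` and `F(exp(β (x + y)) e)` at `y`, where `d` and `e` depend only on `Φ`,
while `α` is the coefficient of `y` in `a` and `β` that of `x` in `b`. The difference `α - β` is the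
coefficient of `xy` in `F(x + y)`, so two solutions with the same `Φ` differ by the same shift `λ`
of `α` and `β`. This is the effect of `exp(λ t)`, which is conjugation by `exp(λ (x + y))`.

Conversely `t^{1,2}` commutes with `u^{12,3}`, and `t^{2,3}` with `u^{1,23}`, while
`t^{1,2} + t^{12,3} = t^{2,3} + t^{1,23}` is the inner derivation of `x + y + z`, which `Φ` fixes
because `ch` is associative.
-/

namespace Ass

/-! ### Noncommutative power series -/

section Series

variable {k : Type*} [Field k] {n m : ℕ}

theorem orderGE_zero (f : Ass k n) : OrderGE 0 f := fun _ hw => absurd hw (Nat.not_lt_zero _)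

theorem orderGE_one_iff {f : Ass k n} : OrderGE 1 f ↔ f [] = 0 :=
  ⟨fun hf => hf [] Nat.one_pos, fun hf w hw => by
    rwa [List.length_eq_zero_iff.mp (Nat.lt_one_iff.mp hw)]⟩

theorem OrderGE.sub {d : ℕ} {f g : Ass k n} (hf : OrderGE d f) (hg : OrderGE d g) :
    OrderGE d (f - g) := fun w hw => by rw [sub_apply, hf w hw, hg w hw, sub_zero]

theorem OrderGE.sum {ι : Type*} {s : Finset ι} {d : ℕ} {f : ι → Ass k n}
    (hf : ∀ i ∈ s, OrderGE d (f i)) : OrderGE d (∑ i ∈ s, f i) := fun w hw => by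
  rw [sum_apply, Finset.sum_eq_zero fun i hi => hf i hi w hw]

theorem OrderGE.shift {d : ℕ} {f : Ass k n} (hf : OrderGE (d + 1) f) (i : Fin n) :
    OrderGE d (shift i f) := fun _ hw => hf _ (Nat.succ_lt_succ hw)

theorem eq_zero_of_forall_orderGE {f : Ass k n} (hf : ∀ d, OrderGE d f) : f = 0 :=
  ext fun w => hf _ w w.length.lt_succ_self

theorem shift_x (i j : Fin n) : shift j (x i : Ass k n) = if j = i then 1 else 0 := by
  ext w
  by_cases h : j = i <;> simp [shift, x, word, one_apply, h]

theorem x_mul_cons (i j : Fin n) (f : Ass k n) (w : List (Fin n)) :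
    (x i * f : Ass k n) (j :: w) = if j = i then f w else 0 := by
  rw [mul_cons, x_nil, shift_x]
  split_ifs <;> simp

theorem mul_x_append (i j : Fin n) (f : Ass k n) (w : List (Fin n)) :
    (f * x i : Ass k n) (w ++ [j]) = if j = i then f w else 0 := by
  induction w generalizing f with
  | nil => simp [mul_cons, x, word]
  | cons l w ih =>
    rw [List.cons_append, mul_cons, ih]
    simp [x, word, shift]

theorem eq_smul_one_add_sum (f : Ass k n) : f = f [] • 1 + ∑ i, x i * shift i f := by
  ext w
  cases w with
  | nil => simp [sum_apply, one_apply, x_nil]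
  | cons j w => simp [sum_apply, one_apply, x_mul_cons, shift]

theorem orderGE_sub_sum_words (f : Ass k n) (N : ℕ) :
    OrderGE (N + 1) (f - ∑ w ∈ words n N, f w • word w) := by
  intro v hv
  rw [sub_apply, sum_apply, sub_eq_zero, Finset.sum_eq_single v]
  · simp [word]
  · intro w _ hne
    simp [word, hne.symm]
  · exact fun hmem => absurd (mem_words.mpr (Nat.lt_succ_iff.mp hv)) hmem

/-- `S` raises the order of a series by at least `r`; for `r = 0` this says that `S` is continuous
of filtered degree `0`, for `r = 1` it makes `∑ S ^ j / j!` converge. -/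
def RaisesOrder (r : ℕ) (S : Ass k n →ₗ[k] Ass k m) : Prop :=
  ∀ d f, OrderGE d f → OrderGE (d + r) (S f)

theorem linearMap_ext_of_word {S T : Ass k n →ₗ[k] Ass k m} (hS : RaisesOrder 0 S)
    (hT : RaisesOrder 0 T) (h : ∀ w, S (word w) = T (word w)) : S = T := by
  refine LinearMap.ext fun f => sub_eq_zero.mp (eq_zero_of_forall_orderGE fun N => ?_)
  have hf := orderGE_sub_sum_words f N
  have hsub := (hS _ _ hf).sub (hT _ _ hf)
  simp only [map_sub, map_sum, map_smul, h, sub_sub_sub_cancel_right] at hsub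
  exact hsub.mono N.le_succ

theorem extend_word {φ : List (Fin n) → Ass k m} (hφ : ∀ w, OrderGE w.length (φ w))
    (w : List (Fin n)) : extend φ (word w) = φ w := by
  ext v
  simp only [extend_apply, word, ite_mul, one_mul, zero_mul]
  rw [Finset.sum_ite_eq']
  split_ifs with hw
  · rfl
  · exact (hφ w v (not_le.mp fun hle => hw (mem_words.mpr hle))).symm

/-- The recursion determines the coefficients of `(S - T) f` degree by degree, so no continuity of
`S` and `T` has to be assumed. -/
theorem linearMap_ext_of_sub_x_mul {S T : Ass k n →ₗ[k] Ass k m} (b : Fin n → Ass k m)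
    (hb : ∀ i, b i [] = 0) (h1 : S 1 = T 1)
    (h : ∀ i f, (S - T) (x i * f) = b i * (S - T) f) : S = T := by
  have horder : ∀ d f, OrderGE d ((S - T) f) := by
    intro d
    induction d with
    | zero => exact fun f => orderGE_zero _
    | succ d ih =>
      intro f
      rw [eq_smul_one_add_sum f, map_add, map_smul, map_sum, LinearMap.sub_apply, h1, sub_self,
        smul_zero, zero_add, add_comm]
      exact OrderGE.sum fun i _ => h i _ ▸ (orderGE_one_iff.mpr (hb i)).mul (ih _)
  exact sub_eq_zero.mp (LinearMap.ext fun f => eq_zero_of_forall_orderGE fun d => horder d f)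

end Series

section AlgHom

variable {k : Type*} [Field k] {n m l : ℕ}

theorem orderGE_pow {f : Ass k n} (hf : f [] = 0) (j : ℕ) : OrderGE j (f ^ j) := by
  induction j with
  | zero => exact orderGE_zero _
  | succ j ih => exact pow_succ f j ▸ ih.mul (orderGE_one_iff.mpr hf)

theorem orderGE_evalSeries_sub_sum (c : ℕ → k) {f : Ass k n} (hf : f [] = 0) (N : ℕ) :
    OrderGE N (evalSeries c f - ∑ j ∈ Finset.range N, c j • f ^ j) := by
  intro w hw
  simp only [evalSeries, sub_apply, sum_apply, smul_apply]
  rw [sub_eq_zero]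
  refine Finset.sum_subset (Finset.range_mono hw) fun j _ hj => ?_
  rw [Finset.mem_range, not_lt] at hj
  rw [orderGE_pow hf j w hj, mul_zero]

theorem isUnit_one_sub {f : Ass k n} (hf : f [] = 0) : IsUnit (1 - f) := by
  set s := evalSeries (fun _ => 1) f
  have hs (N : ℕ) : OrderGE N (s - ∑ j ∈ Finset.range N, f ^ j) := by
    simpa only [one_smul] using orderGE_evalSeries_sub_sum (fun _ => (1 : k)) hf N
  refine isUnit_iff_exists.mpr ⟨s, sub_eq_zero.mp (eq_zero_of_forall_orderGE fun N => ?_),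
    sub_eq_zero.mp (eq_zero_of_forall_orderGE fun N => ?_)⟩
  · have hsplit : (1 - f) * s - 1 = (1 - f) * (s - ∑ j ∈ Finset.range N, f ^ j) - f ^ N := by
      rw [mul_sub, mul_neg_geom_sum]; abel
    exact hsplit ▸ (zero_add N ▸ (orderGE_zero _).mul (hs N)).sub (orderGE_pow hf N)
  · have hsplit : s * (1 - f) - 1 = (s - ∑ j ∈ Finset.range N, f ^ j) * (1 - f) - f ^ N := by
      rw [sub_mul, geom_sum_mul_neg]; abel
    exact hsplit ▸ ((hs N).mul (orderGE_zero _)).sub (orderGE_pow hf N)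

theorem isUnit_of_nil_eq_one {f : Ass k n} (hf : f [] = 1) : IsUnit f := by
  have h : IsUnit (1 - (1 - f)) := isUnit_one_sub (by simp [one_apply, hf])
  rwa [sub_sub_cancel] at h

/-- Otherwise `G` would map the unit `1 - c x_i`, with `c` the inverse of the constant term of
`G x_i`, to a series without constant term. -/
theorem algHom_x_nil (G : Ass k n →ₐ[k] Ass k m) (i : Fin n) : G (x i) [] = 0 := by
  by_contra hne
  have hunit : IsUnit (1 - (G (x i) [])⁻¹ • x i : Ass k n) := isUnit_one_sub (by simp [x_nil])
  obtain ⟨s, hs⟩ := (hunit.map G).exists_right_inv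
  have hnil := congrFun hs []
  simp [hne, one_apply] at hnil

theorem algHom_nil (G : Ass k n →ₐ[k] Ass k m) (f : Ass k n) : G f [] = f [] := by
  conv_lhs => rw [eq_smul_one_add_sum f]
  simp [sum_apply, algHom_x_nil, one_apply]

theorem OrderGE.map {d : ℕ} {f : Ass k n} (hf : OrderGE d f) (G : Ass k n →ₐ[k] Ass k m) :
    OrderGE d (G f) := by
  induction d generalizing f with
  | zero => exact orderGE_zero _
  | succ d ih =>
    rw [eq_smul_one_add_sum f, hf [] d.succ_pos, zero_smul, zero_add, map_sum, add_comm]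
    exact OrderGE.sum fun i _ =>
      map_mul G _ _ ▸ (orderGE_one_iff.mpr (algHom_x_nil G i)).mul (ih (hf.shift i))

theorem algHom_ext {G H : Ass k n →ₐ[k] Ass k m} (h : ∀ i, G (x i) = H (x i)) : G = H := by
  refine AlgHom.toLinearMap_injective (linearMap_ext_of_sub_x_mul (fun i => G (x i))
    (algHom_x_nil G) (by simp) fun i f => ?_)
  simp [h, mul_sub]

theorem algEquiv_ext {F G : Ass k n ≃ₐ[k] Ass k n} (h : ∀ i, F (x i) = G (x i)) : F = G :=
  AlgEquiv.coe_toAlgHom_injective (algHom_ext h)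

theorem map_evalSeries (G : Ass k n →ₐ[k] Ass k m) (c : ℕ → k) {f : Ass k n} (hf : f [] = 0) :
    G (evalSeries c f) = evalSeries c (G f) := by
  refine sub_eq_zero.mp (eq_zero_of_forall_orderGE fun N => ?_)
  have hG := orderGE_evalSeries_sub_sum c ((algHom_nil G f).trans hf) N
  have hsplit := ((orderGE_evalSeries_sub_sum c hf N).map G).sub hG
  simpa only [map_sub, map_sum, map_smul, map_pow, sub_sub_sub_cancel_right] using hsplit

theorem map_exp (G : Ass k n →ₐ[k] Ass k m) {f : Ass k n} (hf : f [] = 0) :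
    G (exp f) = exp (G f) := map_evalSeries G _ hf

theorem map_ln (G : Ass k n →ₐ[k] Ass k m) {f : Ass k n} (hf : f [] = 1) :
    G (ln f) = ln (G f) := by
  rw [ln, map_neg, map_evalSeries G _ (by simp [one_apply, hf]), map_sub, map_one, ln]

/-- Substitution of series `b_i` without constant term for the generators, as a homomorphism of
algebras. -/
noncomputable def substHom (b : Fin n → Ass k m) (hb : ∀ i, b i [] = 0) :
    Ass k n →ₐ[k] Ass k m :=
  AlgHom.ofLinearMap (subst b) (subst_one hb) (subst_mul hb)

theorem substHom_apply {b : Fin n → Ass k m} (hb : ∀ i, b i [] = 0) (f : Ass k n) :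
    substHom b hb f = subst b f := rfl

theorem subst_x {b : Fin n → Ass k m} (hb : ∀ i, b i [] = 0) (i : Fin n) :
    subst b (x i) = b i := by
  simpa [x, subst] using extend_word (orderGE_prod hb) [i]

theorem subst_x_self (f : Ass k n) : subst x f = f :=
  DFunLike.congr_fun (algHom_ext (G := substHom x x_nil) (H := .id k _) (subst_x x_nil)) f

theorem map_subst (G : Ass k m →ₐ[k] Ass k l) {b : Fin n → Ass k m} (hb : ∀ i, b i [] = 0)
    (f : Ass k n) : G (subst b f) = subst (fun i => G (b i)) f := by
  have hGb (i) : G (b i) [] = 0 := (algHom_nil G _).trans (hb i)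
  refine DFunLike.congr_fun (algHom_ext (G := G.comp (substHom b hb)) (H := substHom _ hGb)
    fun i => ?_) f
  simp only [AlgHom.comp_apply, substHom_apply, subst_x hb, subst_x hGb]

/-- The series in the letters `ι i` that `f` contains, read as a series in the letters `i`; for
injective `ι` this substitutes `0` for the other letters. -/
noncomputable def restr (ι : Fin m → Fin n) : Ass k n →ₐ[k] Ass k m :=
  let toLinearMap : Ass k n →ₗ[k] Ass k m :=
    { toFun := fun f w => f (w.map ι), map_add' := fun _ _ => rfl, map_smul' := fun _ _ => rfl }
  have happly (f : Ass k n) (w : List (Fin m)) : toLinearMap f w = f (w.map ι) := rfl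
  AlgHom.ofLinearMap toLinearMap (by ext w; simp [happly, one_apply])
    fun f g => by ext w; simp [happly, mul_apply, List.map_take, List.map_drop]

theorem restr_apply (ι : Fin m → Fin n) (f : Ass k n) (w : List (Fin m)) :
    restr ι f w = f (w.map ι) := rfl

theorem restr_x_of_injective {ι : Fin m → Fin n} (hι : Function.Injective ι) (i : Fin m) :
    restr ι (x (ι i) : Ass k n) = x i := by
  ext w
  have hw : w.map ι = [ι i] ↔ w = [i] := (List.map_injective_iff.mpr hι).eq_iff (b := [i])
  simp [restr_apply, x, word, hw]

theorem restr_x_of_notMem {ι : Fin m → Fin n} {j : Fin n} (hj : j ∉ Set.range ι) :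
    restr ι (x j : Ass k n) = 0 := by
  ext w
  have hw : w.map ι ≠ [j] := fun h => hj <| by
    obtain ⟨i, -, hi⟩ := List.mem_map.mp (h ▸ List.mem_singleton_self j)
    exact ⟨i, hi⟩
  simp [restr_apply, x, word, hw]

end AlgHom

/-! ### Derivations -/

section Der

variable {k : Type*} [Field k] {n m : ℕ}

theorem der_word (u : Fin n → Ass k n) (w : List (Fin n)) : der u (word w) = derWord u w :=
  extend_word (fun w => (orderGE_derWord u w).mono w.length.le_succ) w

theorem der_x_mul (u : Fin n → Ass k n) (i : Fin n) (f : Ass k n) :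
    der u (x i * f) = (x i * u i - u i * x i) * f + x i * der u f := by
  have hx {d : ℕ} {g : Ass k n} (hg : OrderGE d g) : OrderGE (d + 1) (x i * g) :=
    add_comm 1 d ▸ (orderGE_x i).mul hg
  have h : der u ∘ₗ LinearMap.mulLeft k (x i)
      = LinearMap.mulLeft k (x i * u i - u i * x i) + LinearMap.mulLeft k (x i) ∘ₗ der u := by
    refine linearMap_ext_of_word (fun d g hg => (orderGE_der u (hx hg)).mono (by omega))
      (fun d g hg => .add (((orderGE_bracket i (u i)).mul hg).mono (by omega))
        ((hx (orderGE_der u hg)).mono (by omega))) fun w => ?_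
    have hcons : x i * word w = (word (i :: w) : Ass k n) := by
      ext v
      cases v with
      | nil => simp [x_nil, word]
      | cons j v => by_cases hj : j = i <;> simp [x_mul_cons, word, hj]
    simp only [LinearMap.comp_apply, LinearMap.add_apply, LinearMap.mulLeft_apply, hcons, der_word,
      derWord]
  exact LinearMap.congr_fun h f

theorem der_one (u : Fin n → Ass k n) : der u 1 = 0 := der_word u []

theorem der_x (u : Fin n → Ass k n) (i : Fin n) : der u (x i) = x i * u i - u i * x i := by
  simpa [der_one] using der_x_mul u i 1

theorem der_mul (u : Fin n → Ass k n) (f g : Ass k n) :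
    der u (f * g) = der u f * g + f * der u g := by
  have h : der u ∘ₗ LinearMap.mulRight k g
      = LinearMap.mulRight k g ∘ₗ der u + LinearMap.mulRight k (der u g) := by
    refine linearMap_ext_of_sub_x_mul x x_nil (by simp [der_one]) fun i f => ?_
    simp only [LinearMap.sub_apply, LinearMap.comp_apply, LinearMap.add_apply,
      LinearMap.mulRight_apply, der_x_mul, mul_assoc]
    noncomm_ring
  exact LinearMap.congr_fun h f

theorem derivation_ext (G : Ass k n →ₐ[k] Ass k m) {S T : Ass k n →ₗ[k] Ass k m}
    (hS : ∀ f g, S (f * g) = S f * G g + G f * S g) (hT : ∀ f g, T (f * g) = T f * G g + G f * T g)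
    (h : ∀ i, S (x i) = T (x i)) : S = T := by
  have hS1 : S 1 = 0 := by simpa using hS 1 1
  have hT1 : T 1 = 0 := by simpa using hT 1 1
  refine linearMap_ext_of_sub_x_mul (fun i => G (x i)) (algHom_x_nil G) (hS1.trans hT1.symm)
    fun i f => ?_
  rw [LinearMap.sub_apply, LinearMap.sub_apply, hS, hT, h, mul_sub]
  abel

theorem map_der (G : Ass k n →ₐ[k] Ass k m) {u : Fin n → Ass k n} {v : Fin m → Ass k m}
    (h : ∀ i, G (der u (x i)) = der v (G (x i))) (f : Ass k n) : G (der u f) = der v (G f) :=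
  LinearMap.congr_fun (derivation_ext G (S := G.toLinearMap ∘ₗ der u) (T := der v ∘ₗ G.toLinearMap)
    (fun f g => by simp [der_mul]) (fun f g => by simp [der_mul]) h) f

theorem der_add (u v : Fin n → Ass k n) : der (u + v) = der u + der v := by
  refine derivation_ext (.id k _) (der_mul _) (fun f g => ?_) fun i => ?_
  · simp only [LinearMap.add_apply, der_mul, AlgHom.id_apply]
    noncomm_ring
  · simp only [LinearMap.add_apply, der_x, Pi.add_apply]
    noncomm_ring

theorem der_zero : der (0 : Fin n → Ass k n) = 0 := by
  simpa using der_add (0 : Fin n → Ass k n) 0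

theorem der_eq_inner {u : Fin n → Ass k n} {a : Ass k n}
    (h : ∀ i, x i * u i - u i * x i = x i * a - a * x i) (f : Ass k n) :
    der u f = f * a - a * f := by
  refine LinearMap.congr_fun (derivation_ext (.id k _)
    (T := LinearMap.mulRight k a - LinearMap.mulLeft k a) (der_mul u) (fun f g => ?_)
    fun i => ?_) f
  · simp only [LinearMap.sub_apply, LinearMap.mulRight_apply, LinearMap.mulLeft_apply,
      AlgHom.id_apply]
    noncomm_ring
  · simp [der_x, h]

theorem commute_der {u v : Fin n → Ass k n} (huv : ∀ i, der u (v i) = 0)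
    (hvu : ∀ i, der v (u i) = u i * v i - v i * u i) : Commute (der u) (der v) := by
  refine sub_eq_zero.mp (derivation_ext (.id k _) (fun f g => ?_) (fun f g => ?_) fun i => ?_)
  · simp only [LinearMap.sub_apply, Module.End.mul_apply, der_mul, map_add, AlgHom.id_apply]
    noncomm_ring
  · simp
  · simp only [LinearMap.sub_apply, Module.End.mul_apply, der_x, map_sub, der_mul, huv, hvu,
      LinearMap.zero_apply]
    noncomm_ring

theorem restr_der {ι : Fin m → Fin n} (hι : Function.Injective ι) (u : Fin n → Ass k n)
    (f : Ass k n) : restr ι (der u f) = der (fun i => restr ι (u (ι i))) (restr ι f) := by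
  refine map_der (restr ι) (fun j => ?_) f
  rw [der_x, map_sub, map_mul, map_mul]
  by_cases hj : j ∈ Set.range ι
  · obtain ⟨i, rfl⟩ := hj
    rw [restr_x_of_injective hι, der_x]
  · simp [restr_x_of_notMem hj]

end Der

/-! ### Exponentials of operators -/

section OpExp

variable {k : Type*} [Field k] {n m : ℕ}

theorem RaisesOrder.add {r : ℕ} {D E : Ass k n →ₗ[k] Ass k m} (hD : RaisesOrder r D)
    (hE : RaisesOrder r E) : RaisesOrder r (D + E) :=
  fun d f hf => (hD d f hf).add (hE d f hf)

theorem RaisesOrder.pow {D : Module.End k (Ass k n)} (hD : RaisesOrder 1 D) (j : ℕ) :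
    RaisesOrder j (D ^ j) := by
  induction j with
  | zero => exact fun _ _ hf => hf
  | succ j ih => exact fun d f hf => pow_succ' D j ▸ hD _ _ (ih d f hf)

theorem raisesOrder_zero (r : ℕ) : RaisesOrder r (0 : Ass k n →ₗ[k] Ass k m) :=
  fun _ _ _ _ _ => rfl

theorem raisesOrder_der (u : Fin n → Ass k n) : RaisesOrder 1 (der u) :=
  fun _ _ hf => orderGE_der u hf

theorem raisesOrder_mulLeft {r : ℕ} {a : Ass k n} (ha : OrderGE r a) :
    RaisesOrder r (LinearMap.mulLeft k a) :=
  fun d _ hf => add_comm r d ▸ ha.mul hf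

theorem raisesOrder_mulRight {r : ℕ} {a : Ass k n} (ha : OrderGE r a) :
    RaisesOrder r (LinearMap.mulRight k a) :=
  fun _ _ hf => hf.mul ha

theorem raisesOrder_algHom (G : Ass k n →ₐ[k] Ass k m) : RaisesOrder 0 G.toLinearMap :=
  fun _ _ hf => hf.map G

/-- `∑_j D^j / j!`, for an operator `D` that raises the order of series by at least `1`; for such
`D` only the powers up to the length of `w` contribute to the coefficient of `w`. -/
noncomputable def opExp (D : Module.End k (Ass k n)) : Module.End k (Ass k n) where
  toFun f := fun w => ∑ j ∈ Finset.range (w.length + 1), (j.factorial : k)⁻¹ * (D ^ j) f w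
  map_add' f g := funext fun w => by
    change _ = (∑ j ∈ Finset.range (w.length + 1), (j.factorial : k)⁻¹ * (D ^ j) f w)
      + ∑ j ∈ Finset.range (w.length + 1), (j.factorial : k)⁻¹ * (D ^ j) g w
    simp [mul_add, Finset.sum_add_distrib]
  map_smul' r f := funext fun w => by
    change _ = r * ∑ j ∈ Finset.range (w.length + 1), (j.factorial : k)⁻¹ * (D ^ j) f w
    simp [mul_left_comm, Finset.mul_sum]

theorem opExp_apply (D : Module.End k (Ass k n)) (f : Ass k n) (w : List (Fin n)) :
    opExp D f w = ∑ j ∈ Finset.range (w.length + 1), (j.factorial : k)⁻¹ * (D ^ j) f w := rfl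

theorem opExp_nil (D : Module.End k (Ass k n)) (f : Ass k n) : opExp D f [] = f [] := by
  simp [opExp_apply]

theorem opExp_of_apply_eq_zero {D : Module.End k (Ass k n)} {f : Ass k n} (h : D f = 0) :
    opExp D f = f := by
  ext w
  rw [opExp_apply, Finset.sum_range_succ']
  simp [pow_succ, h]

theorem opExp_zero : opExp (0 : Module.End k (Ass k n)) = 1 :=
  LinearMap.ext fun _ => opExp_of_apply_eq_zero rfl

theorem RaisesOrder.orderGE_opExp_sub_sum {D : Module.End k (Ass k n)} (hD : RaisesOrder 1 D)
    (f : Ass k n) (N : ℕ) :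
    OrderGE N (opExp D f - ∑ j ∈ Finset.range N, (j.factorial : k)⁻¹ • (D ^ j) f) := by
  intro w hw
  rw [sub_apply, sum_apply, opExp_apply, sub_eq_zero]
  refine Finset.sum_subset (Finset.range_mono hw) fun j _ hj => ?_
  rw [Finset.mem_range, not_lt] at hj
  rw [hD.pow j 0 f (orderGE_zero f) w (by omega), mul_zero]

theorem RaisesOrder.opExp {D : Module.End k (Ass k n)} (hD : RaisesOrder 1 D) :
    RaisesOrder 0 (opExp D) := fun d f hf w hw => by
  rw [opExp_apply]
  exact Finset.sum_eq_zero fun j _ => by rw [hD.pow j d f hf w (by omega), mul_zero]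

theorem map_opExp {S : Ass k n →ₗ[k] Ass k m} (hS : RaisesOrder 0 S) {D : Module.End k (Ass k n)}
    (hD : RaisesOrder 1 D) {E : Module.End k (Ass k m)} (hE : RaisesOrder 1 E)
    (h : ∀ f, S (D f) = E (S f)) (f : Ass k n) : S (opExp D f) = opExp E (S f) := by
  have hpow (j : ℕ) : S ((D ^ j) f) = (E ^ j) (S f) := by
    induction j with
    | zero => rfl
    | succ j ih => rw [pow_succ', pow_succ', Module.End.mul_apply, Module.End.mul_apply, h, ih]
  refine sub_eq_zero.mp (eq_zero_of_forall_orderGE fun N => ?_)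
  have hsub := (hS N _ (hD.orderGE_opExp_sub_sum f N)).sub (hE.orderGE_opExp_sub_sum (S f) N)
  simpa only [map_sub, map_sum, map_smul, hpow, sub_sub_sub_cancel_right, add_zero] using hsub

theorem commute_opExp {D E : Module.End k (Ass k n)} (hD : RaisesOrder 1 D) (hE : RaisesOrder 1 E)
    (h : Commute D E) : Commute (opExp D) (opExp E) := by
  have hcomm (f : Ass k n) : E (opExp D f) = opExp D (E f) :=
    map_opExp (fun d f hf => (hE d f hf).mono (Nat.le_succ d)) hD hD
      (fun f => (LinearMap.congr_fun h.eq f).symm) f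
  exact LinearMap.ext fun f => map_opExp hD.opExp hE hE (fun f => (hcomm f).symm) f

theorem leibniz_pow {D E F : Module.End k (Ass k n)} (h : ∀ f g, D (f * g) = E f * g + f * F g)
    (f g : Ass k n) (r : ℕ) :
    (D ^ r) (f * g) = ∑ q ∈ Finset.HasAntidiagonal.antidiagonal r,
      r.choose q.1 • ((E ^ q.1) f * (F ^ q.2) g) := by
  induction r with
  | zero => simp
  | succ r ih =>
    rw [Finset.sum_antidiagonal_choose_succ_nsmul (fun i j => (E ^ i) f * (F ^ j) g), pow_succ',
      Module.End.mul_apply, ih, map_sum, ← Finset.sum_add_distrib]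
    refine Finset.sum_congr rfl fun q hq => ?_
    rw [Finset.HasAntidiagonal.mem_antidiagonal] at hq
    rw [map_nsmul, h, ← hq, Nat.choose_symm_add, pow_succ', pow_succ', Module.End.mul_apply,
      Module.End.mul_apply, smul_add, add_comm]

variable [CharZero k]

theorem sum_range_inv_factorial_mul {N : ℕ} {h : ℕ → k} {g : ℕ → ℕ → k}
    (hg : ∀ i j, N ≤ i + j → g i j = 0)
    (hh : ∀ r, h r = ∑ q ∈ Finset.HasAntidiagonal.antidiagonal r, r.choose q.1 * g q.1 q.2) :
    ∑ r ∈ Finset.range N, (r.factorial : k)⁻¹ * h r = ∑ i ∈ Finset.range N,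
      ∑ j ∈ Finset.range N, (i.factorial : k)⁻¹ * (j.factorial : k)⁻¹ * g i j := by
  have hterm (r : ℕ) : (r.factorial : k)⁻¹ * h r = ∑ i ∈ Finset.range (r + 1),
      (i.factorial : k)⁻¹ * ((r - i).factorial : k)⁻¹ * g i (r - i) := by
    rw [hh, Finset.Nat.sum_antidiagonal_eq_sum_range_succ_mk, Finset.mul_sum]
    refine Finset.sum_congr rfl fun i hi => ?_
    have hr : (r.factorial : k) ≠ 0 := Nat.cast_ne_zero.mpr r.factorial_ne_zero
    rw [Nat.cast_choose k (Finset.mem_range_succ_iff.mp hi)]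
    field_simp
  simp_rw [hterm]
  rw [Finset.sum_range_diag_flip N fun i j => (i.factorial : k)⁻¹ * (j.factorial : k)⁻¹ * g i j]
  refine Finset.sum_congr rfl fun i _ =>
    Finset.sum_subset (Finset.range_mono (Nat.sub_le N i)) fun j _ hj => ?_
  rw [Finset.mem_range, not_lt] at hj
  rw [hg i j (by omega), mul_zero]

theorem opExp_add {D E : Module.End k (Ass k n)} (hD : RaisesOrder 1 D) (hE : RaisesOrder 1 E)
    (h : Commute D E) : opExp (D + E) = opExp D * opExp E := by
  ext f w
  have happly (i : ℕ) : (D ^ i) (opExp E f) w = ∑ j ∈ Finset.range (w.length + 1),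
      (j.factorial : k)⁻¹ * (D ^ i) ((E ^ j) f) w := by
    have hsub := hD.pow i _ _ (hE.orderGE_opExp_sub_sum f (w.length + 1)) w (by omega)
    simpa only [map_sub, map_sum, map_smul, sub_apply, sum_apply, smul_apply, sub_eq_zero]
      using hsub
  rw [Module.End.mul_apply, opExp_apply, opExp_apply]
  simp_rw [happly, Finset.mul_sum, ← mul_assoc]
  refine sum_range_inv_factorial_mul (fun i j hij => ?_) fun r => ?_
  · exact hD.pow i _ _ (hE.pow j _ _ (orderGE_zero f)) w (by omega)
  · rw [h.add_pow', LinearMap.sum_apply, sum_apply]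
    refine Finset.sum_congr rfl fun q _ => ?_
    rw [← Nat.cast_smul_eq_nsmul k]
    rfl

theorem opExp_mul {D E F : Module.End k (Ass k n)} (hE : RaisesOrder 1 E) (hF : RaisesOrder 1 F)
    (h : ∀ f g, D (f * g) = E f * g + f * F g) (f g : Ass k n) :
    opExp D (f * g) = opExp E f * opExp F g := by
  ext w
  set N := w.length + 1
  set a := ∑ j ∈ Finset.range N, (j.factorial : k)⁻¹ • (E ^ j) f with ha
  set b := ∑ j ∈ Finset.range N, (j.factorial : k)⁻¹ • (F ^ j) g with hb
  have htrunc : (opExp E f * opExp F g) w = (a * b) w := by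
    have hsplit : opExp E f * opExp F g - a * b
        = (opExp E f - a) * opExp F g + a * (opExp F g - b) := by noncomm_ring
    have hmul : OrderGE N (opExp E f * opExp F g - a * b) :=
      hsplit ▸ ((hE.orderGE_opExp_sub_sum f N).mul (orderGE_zero _)).add
        (zero_add N ▸ (orderGE_zero a).mul (hF.orderGE_opExp_sub_sum g N))
    exact sub_eq_zero.mp (hmul w w.length.lt_succ_self)
  rw [htrunc, ha, hb, Finset.sum_mul_sum, sum_apply, opExp_apply]
  simp_rw [sum_apply, smul_mul_smul_comm, smul_apply]
  refine sum_range_inv_factorial_mul (fun i j hij => ?_) fun r => ?_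
  · exact ((hE.pow i _ _ (orderGE_zero f)).mul (hF.pow j _ _ (orderGE_zero g))) w (by omega)
  · rw [leibniz_pow h, sum_apply]
    refine Finset.sum_congr rfl fun q _ => ?_
    rw [← Nat.cast_smul_eq_nsmul k, smul_apply]

end OpExp

/-! ### The exponential series -/

section Exp

variable {k : Type*} [Field k] {n : ℕ}

theorem raisesOrder_mulLeft_of_nil {a : Ass k n} (ha : a [] = 0) :
    RaisesOrder 1 (LinearMap.mulLeft k a) := raisesOrder_mulLeft (orderGE_one_iff.mpr ha)

theorem raisesOrder_mulRight_of_nil {a : Ass k n} (ha : a [] = 0) :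
    RaisesOrder 1 (LinearMap.mulRight k a) := raisesOrder_mulRight (orderGE_one_iff.mpr ha)

theorem opExp_mulLeft_one (a : Ass k n) : opExp (LinearMap.mulLeft k a) 1 = exp a := by
  ext w
  simp only [opExp_apply, LinearMap.pow_mulLeft, LinearMap.mulLeft_apply, mul_one]
  rfl

theorem opExp_mulRight_one (a : Ass k n) : opExp (LinearMap.mulRight k a) 1 = exp a := by
  ext w
  simp only [opExp_apply, LinearMap.pow_mulRight, LinearMap.mulRight_apply, one_mul]
  rfl

theorem exp_nil (a : Ass k n) : exp a [] = 1 := by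
  rw [← opExp_mulLeft_one, opExp_nil]
  rfl

theorem exp_zero : exp (0 : Ass k n) = 1 := by
  rw [← opExp_mulLeft_one, opExp_of_apply_eq_zero (by simp)]

variable [CharZero k]

theorem opExp_mulLeft {a : Ass k n} (ha : a [] = 0) (f : Ass k n) :
    opExp (LinearMap.mulLeft k a) f = exp a * f := by
  have h := opExp_mul (raisesOrder_mulLeft_of_nil ha) (raisesOrder_zero 1)
    (D := LinearMap.mulLeft k a) (fun f g => by simp [mul_assoc]) 1 f
  rwa [one_mul, opExp_zero, opExp_mulLeft_one] at h

theorem exp_add_of_commute {a b : Ass k n} (ha : a [] = 0) (hb : b [] = 0) (h : Commute a b) :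
    exp (a + b) = exp a * exp b := by
  have hcomm : Commute (LinearMap.mulLeft k a) (LinearMap.mulLeft k b) :=
    h.map (Algebra.lmul k (Ass k n))
  have hadd : LinearMap.mulLeft k (a + b) = LinearMap.mulLeft k a + LinearMap.mulLeft k b :=
    map_add (LinearMap.mul k (Ass k n)) a b
  rw [← opExp_mulLeft_one, hadd, opExp_add (raisesOrder_mulLeft_of_nil ha)
    (raisesOrder_mulLeft_of_nil hb) hcomm, Module.End.mul_apply, opExp_mulLeft_one,
    opExp_mulLeft ha]

theorem exp_smul_mul_exp_smul (b c : k) {a : Ass k n} (ha : a [] = 0) :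
    exp (b • a) * exp (c • a) = exp ((b + c) • a) := by
  rw [add_smul, exp_add_of_commute (by simp [ha]) (by simp [ha])
    (((Commute.refl a).smul_left b).smul_right c)]

theorem exp_mul_exp_neg {a : Ass k n} (ha : a [] = 0) : exp a * exp (-a) = 1 := by
  rw [← exp_add_of_commute ha (by simp [ha]) (Commute.neg_right (Commute.refl a)),
    add_neg_cancel, exp_zero]

theorem commute_exp_left {a b : Ass k n} (ha : a [] = 0) (h : Commute a b) :
    Commute (exp a) b := by
  have hmap := map_opExp (raisesOrder_mulLeft (orderGE_zero b)) (raisesOrder_mulLeft_of_nil ha)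
    (raisesOrder_mulLeft_of_nil ha) (fun f => by
      simp only [LinearMap.mulLeft_apply, ← mul_assoc, h.eq]) 1
  simpa only [opExp_mulLeft ha, LinearMap.mulLeft_apply, mul_one] using! hmap.symm

end Exp

/-! ### Exponential and logarithm -/

section ExpLn

variable {k : Type*} [Field k] {n m : ℕ}

theorem commute_of_one_variable (a b : Ass k 1) : Commute a b := by
  have heq {v w : List (Fin 1)} (h : v.length = w.length) : v = w :=
    List.ext_getElem h fun _ _ _ => Subsingleton.elim _ _
  ext w
  rw [mul_apply, mul_apply, ← Finset.sum_range_reflect]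
  refine Finset.sum_congr rfl fun i hi => ?_
  rw [Finset.mem_range] at hi
  rw [mul_comm, heq (v := w.drop (w.length + 1 - 1 - i)) (w := w.take i) (by simp; omega),
    heq (v := w.take (w.length + 1 - 1 - i)) (w := w.drop i) (by simp)]

/-- The Euler derivation, which multiplies a series of degree `d` by `d`. -/
def euler : Ass k n →ₗ[k] Ass k n where
  toFun f := fun w => w.length * f w
  map_add' f g := ext fun _ => mul_add _ (f _) (g _)
  map_smul' c f := ext fun _ => mul_left_comm _ c (f _)

theorem euler_apply (f : Ass k n) (w : List (Fin n)) : euler f w = w.length * f w := rfl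

theorem euler_mul (f g : Ass k n) : euler (f * g) = euler f * g + f * euler g := by
  ext w
  rw [euler_apply, add_apply, mul_apply, mul_apply, mul_apply, Finset.mul_sum,
    ← Finset.sum_add_distrib]
  refine Finset.sum_congr rfl fun i hi => ?_
  rw [Finset.mem_range] at hi
  rw [euler_apply, euler_apply, List.length_take, List.length_drop, min_eq_left (by omega),
    Nat.cast_sub (by omega)]
  ring

theorem euler_one : euler (1 : Ass k n) = 0 := by
  simpa using euler_mul (1 : Ass k n) 1

theorem euler_x (i : Fin n) : euler (x i : Ass k n) = x i := by
  ext w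
  by_cases hw : w = [i] <;> simp [euler_apply, x, word, hw]

theorem OrderGE.euler {d : ℕ} {f : Ass k n} (hf : OrderGE d f) : OrderGE d (euler f) :=
  fun w hw => by rw [euler_apply, hf w hw, mul_zero]

theorem euler_pow_succ {a : Ass k n} (h : Commute a (euler a)) (j : ℕ) :
    euler (a ^ (j + 1)) = (j + 1 : k) • (a ^ j * euler a) := by
  induction j with
  | zero => simp
  | succ j ih =>
    rw [pow_succ, euler_mul, ih, smul_mul_assoc, mul_assoc, ← h.eq, ← mul_assoc, ← pow_succ]
    push_cast
    module

theorem ln_nil (b : Ass k n) : ln b [] = 0 := by simp [ln, evalSeries]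

theorem x_pow_apply (j : ℕ) (w : List (Fin 1)) :
    ((x 0 : Ass k 1) ^ j) w = if w.length = j then 1 else 0 := by
  induction j generalizing w with
  | zero => simp [one_apply]
  | succ j ih =>
    cases w with
    | nil => simp [pow_succ', x_nil]
    | cons i w => rw [pow_succ', x_mul_cons, ih]; simp [Subsingleton.elim i 0]

theorem ln_one_sub_x_apply (w : List (Fin 1)) :
    ln (1 - x 0 : Ass k 1) w = -(w.length : k)⁻¹ := by
  simp [ln, evalSeries, x_pow_apply]

theorem subst_ch {b : Fin 2 → Ass k m} (hb : ∀ i, b i [] = 0) :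
    subst b (ch k) = ln (exp (b 0) * exp (b 1)) := by
  rw [← substHom_apply hb, ch, map_ln _ (by simp [exp_nil]), map_mul, map_exp _ (x_nil 0),
    map_exp _ (x_nil 1)]
  simp only [substHom_apply, subst_x hb]

theorem subst_ch_nil (b : Fin 2 → Ass k m) (hb : ∀ i, b i [] = 0) : subst b (ch k) [] = 0 := by
  rw [← substHom_apply hb, algHom_nil, ch_nil]

theorem pair_nil {a b : Ass k n} (ha : a [] = 0) (hb : b [] = 0) (i : Fin 2) :
    (![a, b] : Fin 2 → Ass k n) i [] = 0 := by
  fin_cases i <;> assumption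

variable [CharZero k]

theorem euler_exp {a : Ass k n} (ha : a [] = 0) (h : Commute a (euler a)) :
    euler (exp a) = exp a * euler a := by
  set s : ℕ → Ass k n := fun N => ∑ j ∈ Finset.range N, (j.factorial : k)⁻¹ • a ^ j with hs
  have hexp (N : ℕ) : OrderGE N (exp a - s N) := orderGE_evalSeries_sub_sum _ ha N
  have hterm (j : ℕ) : euler (((j + 1).factorial : k)⁻¹ • a ^ (j + 1))
      = ((j.factorial : k)⁻¹ • a ^ j) * euler a := by
    have hj : (j.factorial : k) ≠ 0 := Nat.cast_ne_zero.mpr j.factorial_ne_zero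
    have hj1 : (j + 1 : k) ≠ 0 := by exact_mod_cast j.succ_ne_zero
    rw [map_smul, euler_pow_succ h, smul_smul, smul_mul_assoc, Nat.factorial_succ]
    congr 1
    push_cast
    field_simp
  have hsum (N : ℕ) : euler (s (N + 1)) = s N * euler a := by
    simp only [hs, Finset.sum_range_succ', map_add, map_sum, hterm, Finset.sum_mul, pow_zero,
      map_smul, euler_one, smul_zero, add_zero]
  refine sub_eq_zero.mp (eq_zero_of_forall_orderGE fun N => ?_)
  have hsplit : euler (exp a) - exp a * euler a
      = euler (exp a - s (N + 1)) - (exp a - s N) * euler a := by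
    rw [map_sub, hsum, sub_mul]; abel
  exact hsplit ▸ ((hexp (N + 1)).mono N.le_succ).euler.sub ((hexp N).mul (orderGE_zero _))

/-- For the logarithm in one variable this is `(1 - x) · x · d/dx ln (1 - x) = -x`. -/
theorem one_sub_x_mul_euler_ln : (1 - x 0 : Ass k 1) * euler (ln (1 - x 0)) = -x 0 := by
  have heuler (w : List (Fin 1)) : euler (ln (1 - x 0 : Ass k 1)) w = if w = [] then 0 else -1 := by
    rw [euler_apply, ln_one_sub_x_apply]
    split_ifs with hw
    · simp [hw]
    · rw [mul_neg, mul_inv_cancel₀ (by simpa using hw)]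
  rw [sub_mul, one_mul]
  ext w
  cases w with
  | nil => simp [heuler, x_nil]
  | cons i w =>
    obtain rfl := Subsingleton.elim i 0
    rw [sub_apply, x_mul_cons, neg_apply, heuler, heuler]
    cases w <;> simp [x, word]

theorem eq_zero_of_one_sub_x_mul_euler {f : Ass k 1} (hnil : f [] = 0)
    (h : (1 - x 0) * euler f = -(x 0 * f)) : f = 0 := by
  ext w
  induction w with
  | nil => exact hnil
  | cons i w ih =>
    have hcoeff := congrFun h (i :: w)
    rw [sub_mul, one_mul, sub_apply, neg_apply, x_mul_cons, x_mul_cons,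
      if_pos (Subsingleton.elim i 0), if_pos (Subsingleton.elim i 0), euler_apply, euler_apply, ih,
      List.length_cons] at hcoeff
    simpa [Nat.cast_add_one_ne_zero] using hcoeff

theorem exp_ln_one_sub_x : exp (ln (1 - x 0 : Ass k 1)) = 1 - x 0 := by
  refine sub_eq_zero.mp (eq_zero_of_one_sub_x_mul_euler (by simp [exp_nil, one_apply, x_nil]) ?_)
  rw [map_sub, euler_exp (ln_nil _) (commute_of_one_variable _ _),
    (commute_of_one_variable (exp _) _).eq, map_sub, euler_one, euler_x, mul_sub, ← mul_assoc,
    one_sub_x_mul_euler_ln]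
  noncomm_ring

/-- Substitute `1 - b` for the variable in the case of one variable. -/
theorem exp_ln {b : Ass k n} (hb : b [] = 1) : exp (ln b) = b := by
  have hc (_ : Fin 1) : (1 - b) [] = 0 := by simp [hb, one_apply]
  have hx : substHom (fun _ : Fin 1 => 1 - b) hc (1 - x 0) = b := by
    rw [map_sub, map_one, substHom_apply, subst_x hc, sub_sub_cancel]
  have h := congrArg (substHom (fun _ : Fin 1 => 1 - b) hc) (exp_ln_one_sub_x (k := k))
  rwa [map_exp _ (ln_nil _), map_ln _ (by simp [one_apply, x_nil]), hx] at h

theorem ch_assoc {a b c : Ass k n} (ha : a [] = 0) (hb : b [] = 0) (hc : c [] = 0) :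
    subst ![subst ![a, b] (ch k), c] (ch k) = subst ![a, subst ![b, c] (ch k)] (ch k) := by
  have hab : subst ![a, b] (ch k) [] = 0 := subst_ch_nil _ (pair_nil ha hb)
  have hbc : subst ![b, c] (ch k) [] = 0 := subst_ch_nil _ (pair_nil hb hc)
  rw [subst_ch (pair_nil hab hc), subst_ch (pair_nil ha hbc), subst_ch (pair_nil ha hb),
    subst_ch (pair_nil hb hc)]
  simp only [Matrix.cons_val_zero, Matrix.cons_val_one]
  rw [exp_ln (by simp [exp_nil]), exp_ln (by simp [exp_nil]), mul_assoc]

end ExpLn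

/-! ### Exponentials of derivations -/

section ExpAut

variable {k : Type*} [Field k] [CharZero k] {n m : ℕ}

theorem expAut_eq_opExp (u : Fin n → Ass k n) (f : Ass k n) : expAut u f = opExp (der u) f := rfl

theorem expAut_of_der_eq_zero {u : Fin n → Ass k n} {f : Ass k n} (h : der u f = 0) :
    expAut u f = f := opExp_of_apply_eq_zero h

theorem expAut_zero (f : Ass k n) : expAut (0 : Fin n → Ass k n) f = f :=
  expAut_of_der_eq_zero (by rw [der_zero, LinearMap.zero_apply])

theorem map_expAut (G : Ass k n →ₐ[k] Ass k m) {u : Fin n → Ass k n} {v : Fin m → Ass k m}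
    (h : ∀ i, G (der u (x i)) = der v (G (x i))) (f : Ass k n) :
    G (expAut u f) = expAut v (G f) :=
  map_opExp (raisesOrder_algHom G) (raisesOrder_der u) (raisesOrder_der v) (map_der G h) f

/-- `exp(u)`, as an automorphism of the algebra of series. -/
noncomputable def expAlgEquiv (u : Fin n → Ass k n) : Ass k n ≃ₐ[k] Ass k n :=
  .ofLinearEquiv (expAut u) (expAut_of_der_eq_zero (der_one u))
    (opExp_mul (raisesOrder_der u) (raisesOrder_der u) (der_mul u))

theorem expAlgEquiv_apply (u : Fin n → Ass k n) (f : Ass k n) : expAlgEquiv u f = expAut u f := rfl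

theorem expAut_add_of_commute {u v : Fin n → Ass k n} (h : Commute (der u) (der v)) :
    expAut (u + v) = expAut u * expAut v :=
  LinearEquiv.ext fun f => by
    rw [expAut_eq_opExp, der_add, opExp_add (raisesOrder_der u) (raisesOrder_der v) h]
    rfl

theorem commute_expAut {u v : Fin n → Ass k n} (h : Commute (der u) (der v)) :
    Commute (expAut u) (expAut v) :=
  LinearEquiv.ext fun f =>
    LinearMap.congr_fun (commute_opExp (raisesOrder_der u) (raisesOrder_der v) h) f

theorem expAut_eq_conj {u : Fin n → Ass k n} {a : Ass k n} (ha : a [] = 0)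
    (h : ∀ i, x i * u i - u i * x i = x i * a - a * x i) (f : Ass k n) :
    expAut u f = exp (-a) * f * exp a := by
  have hneg : (-a) [] = 0 := by simp [ha]
  have hL := opExp_mul (D := der u) (raisesOrder_mulLeft_of_nil hneg)
    (raisesOrder_mulRight_of_nil ha) (fun f g => by
      simp only [der_eq_inner h, LinearMap.mulLeft_apply, LinearMap.mulRight_apply]
      noncomm_ring) f 1
  rwa [mul_one, opExp_mulLeft hneg, opExp_mulRight_one] at hL

end ExpAut

/-! ### Conjugators -/

section Conjugator

variable {k : Type*} [Field k] {n m : ℕ}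

/-- The operator `f ↦ a f + u(f)` for a series `a` and a derivation `u`, that is, the element
`(a, u)` of the semidirect product of series and derivations. -/
noncomputable def twist (a : Ass k n) (u : Fin n → Ass k n) : Module.End k (Ass k n) :=
  LinearMap.mulLeft k a + der u

theorem twist_apply (a : Ass k n) (u : Fin n → Ass k n) (f : Ass k n) :
    twist a u f = a * f + der u f := rfl

theorem raisesOrder_twist {a : Ass k n} (ha : a [] = 0) (u : Fin n → Ass k n) :
    RaisesOrder 1 (twist a u) := (raisesOrder_mulLeft_of_nil ha).add (raisesOrder_der u)

/-- The series `c` with `exp(a + u) = c exp(u)` as operators, where `a` acts by multiplication and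
`u` as a derivation. For `a = u_i` it conjugates `x_i` to `exp(u)(x_i)`. -/
noncomputable def cocycle (a : Ass k n) (u : Fin n → Ass k n) : Ass k n := opExp (twist a u) 1

theorem cocycle_nil (a : Ass k n) (u : Fin n → Ass k n) : cocycle a u [] = 1 := opExp_nil _ 1

theorem cocycle_zero_left (u : Fin n → Ass k n) : cocycle 0 u = 1 :=
  opExp_of_apply_eq_zero (by rw [twist_apply, zero_mul, der_one, zero_add])

theorem cocycle_zero_right (a : Ass k n) : cocycle a 0 = exp a := by
  rw [cocycle, twist, der_zero, add_zero, opExp_mulLeft_one]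

theorem map_cocycle (G : Ass k n →ₐ[k] Ass k m) {u : Fin n → Ass k n} {v : Fin m → Ass k m}
    (h : ∀ i, G (der u (x i)) = der v (G (x i))) {a : Ass k n} (ha : a [] = 0) :
    G (cocycle a u) = cocycle (G a) v := by
  have hGa : G a [] = 0 := (algHom_nil G a).trans ha
  have hmap := map_opExp (raisesOrder_algHom G) (raisesOrder_twist ha u) (raisesOrder_twist hGa v)
    (fun f => by simp [twist_apply, map_der G h]) 1
  rwa [AlgHom.toLinearMap_apply, AlgHom.toLinearMap_apply, map_one G] at hmap

/-- `c` is a conjugating series of the tangential automorphism `F` at the generator `x_i`, that is,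
`F(x_i) = c⁻¹ x_i c`. -/
structure IsConjugator (F : Ass k n ≃ₐ[k] Ass k n) (i : Fin n) (c : Ass k n) : Prop where
  nil : c [] = 1
  x_mul : x i * c = c * F (x i)

namespace IsConjugator

variable {F G : Ass k n ≃ₐ[k] Ass k n} {i : Fin n} {c d : Ass k n}

theorem isUnit (hc : IsConjugator F i c) : IsUnit c := isUnit_of_nil_eq_one hc.nil

theorem mul (hc : IsConjugator F i c) (hd : IsConjugator G i d) :
    IsConjugator (F * G) i (c * F d) where
  nil := by rw [mul_nil, hc.nil, one_mul, ← hd.nil]; exact algHom_nil F.toAlgHom d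
  x_mul := by
    rw [← mul_assoc, hc.x_mul, mul_assoc, ← map_mul, hd.x_mul, map_mul, ← mul_assoc,
      AlgEquiv.mul_apply]

theorem exists_inv (hc : IsConjugator F i c) : ∃ d, IsConjugator F⁻¹ i d := by
  obtain ⟨b, hbc, hcb⟩ := isUnit_iff_exists.mp hc.isUnit
  have hb : b [] = 1 := by simpa [hc.nil, one_apply] using congrFun hbc []
  refine ⟨F.symm b, (algHom_nil F.symm.toAlgHom b).trans hb, F.injective ?_⟩
  calc F (x i * F.symm b) = b * c * F (x i) * b := by simp [hcb]
    _ = F (F.symm b * F⁻¹ (x i)) := by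
      rw [mul_assoc b, ← hc.x_mul, mul_assoc, mul_assoc, hbc, mul_one, map_mul, F.apply_symm_apply]
      exact congrArg (b * ·) (F.apply_symm_apply (x i)).symm

theorem mul_left_of_commute {a : Ass k n} (ha : a [] = 1) (h : Commute a (x i))
    (hc : IsConjugator F i c) : IsConjugator F i (a * c) where
  nil := by rw [mul_nil, ha, hc.nil, one_mul]
  x_mul := by rw [← mul_assoc, ← h.eq, mul_assoc, hc.x_mul, mul_assoc]

theorem exists_commute (hc : IsConjugator F i c) (hd : IsConjugator F i d) :
    ∃ a : Ass k n, a [] = 1 ∧ Commute a (x i) ∧ d = a * c := by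
  obtain ⟨b, hbc, hcb⟩ := isUnit_iff_exists.mp hc.isUnit
  refine ⟨d * b, ?_, ?_, by rw [mul_assoc, hcb, mul_one]⟩
  · have hb := congrFun hbc []
    rw [mul_nil, hc.nil, one_mul] at hb
    rw [mul_nil, hd.nil, hb, one_mul, one_apply, if_pos rfl]
  · calc
      d * b * x i = d * b * (x i * c) * b := by
        rw [mul_assoc (d * b), mul_assoc (x i), hbc, mul_one]
      _ = x i * (d * b) := by
        rw [hc.x_mul, ← mul_assoc, mul_assoc d, hcb, mul_one, ← hd.x_mul, mul_assoc]

theorem apply_x_eq (hc : IsConjugator F i c) (hd : IsConjugator G i c) : F (x i) = G (x i) :=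
  hc.isUnit.mul_left_cancel (hc.x_mul.symm.trans hd.x_mul)

end IsConjugator

theorem apply_eq_zero_of_commute_x {a : Ass k n} {i j : Fin n} (h : Commute a (x i)) (hji : j ≠ i)
    {w : List (Fin n)} (hj : j ∈ w) : a w = 0 := by
  obtain ⟨p, v, rfl⟩ := List.append_of_mem hj
  have hrotate (l : Fin n) (w : List (Fin n)) :
      a (l :: w) = if l = i then a (w ++ [i]) else 0 := by
    have hcoeff := congrFun h.eq (l :: w ++ [i])
    rwa [mul_x_append, if_pos rfl, List.cons_append, x_mul_cons] at hcoeff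
  induction p generalizing v with
  | nil => rw [List.nil_append, hrotate, if_neg hji]
  | cons l p ih =>
    rw [List.cons_append, hrotate]
    split_ifs
    · rw [List.append_assoc]
      exact ih (v ++ [i]) (by simp)
    · rfl

namespace IsConjugator

variable {F : Ass k n ≃ₐ[k] Ass k n} {i : Fin n} {c d : Ass k n}

theorem restr_eq {ι : Fin m → Fin n} (hi : i ∉ Set.range ι) (hc : IsConjugator F i c)
    (hd : IsConjugator F i d) : restr ι c = restr ι d := by
  obtain ⟨a, hnil, hcomm, rfl⟩ := hc.exists_commute hd
  have ha : restr ι a = 1 := by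
    ext w
    rw [restr_apply, one_apply]
    cases w with
    | nil => exact hnil
    | cons j w => exact apply_eq_zero_of_commute_x hcomm (fun h => hi ⟨j, h⟩) (by simp)
  rw [map_mul, ha, one_mul]

theorem eq_of_restr_eq (hc : IsConjugator F i c) (hd : IsConjugator F i d)
    (h : restr (fun _ : Fin 1 => i) c = restr (fun _ : Fin 1 => i) d) : c = d := by
  obtain ⟨a, -, hcomm, rfl⟩ := hc.exists_commute hd
  have ha : restr (fun _ : Fin 1 => i) a = 1 := by
    rw [map_mul] at h
    exact (hc.isUnit.map (restr _)).mul_left_injective (by simpa using h.symm)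
  suffices a = 1 by rw [this, one_mul]
  ext w
  by_cases hw : ∀ j ∈ w, j = i
  · have hcoeff := congrFun ha (List.replicate w.length 0)
    rw [restr_apply, List.map_replicate, ← List.eq_replicate_of_mem hw] at hcoeff
    simp [hcoeff, one_apply]
  · push Not at hw
    obtain ⟨j, hj, hji⟩ := hw
    rw [apply_eq_zero_of_commute_x hcomm hji hj, one_apply, if_neg (List.ne_nil_of_mem hj)]

theorem symm_apply_x_eq {G : Ass k n ≃ₐ[k] Ass k n} (hF : IsConjugator F i (F d))
    (hG : IsConjugator G i (G d)) : F.symm (x i) = G.symm (x i) := by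
  have hd : IsUnit d := by simpa using hF.isUnit.map F.symm
  have key {H : Ass k n ≃ₐ[k] Ass k n} (hH : IsConjugator H i (H d)) : H.symm (x i) * d = d * x i :=
    H.injective (by rw [map_mul, H.apply_symm_apply, map_mul, hH.x_mul])
  exact hd.mul_right_cancel ((key hF).trans (key hG).symm)

theorem mul_inner [CharZero k] {T : Ass k n ≃ₐ[k] Ass k n} {a : Ass k n} (ha : a [] = 0)
    (hT : ∀ f, T f = exp (-a) * f * exp a) (hd : IsConjugator F i (F d)) :
    IsConjugator (F * T) i ((F * T) (exp a * d)) where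
  nil := by
    have hdnil : d [] = 1 := (algHom_nil F.toAlgHom d).symm.trans hd.nil
    refine (algHom_nil (F * T).toAlgHom _).trans ?_
    rw [mul_nil, exp_nil, hdnil, one_mul]
  x_mul := by
    have hneg : exp (-a) * exp a = 1 := by
      simpa using exp_mul_exp_neg (a := -a) (by simp [ha])
    have hT_mul (f : Ass k n) : T (exp a * f) = f * exp a := by
      rw [hT, ← mul_assoc, hneg, one_mul]
    calc x i * (F * T) (exp a * d) = x i * F d * F (exp a) := by
          rw [AlgEquiv.mul_apply, hT_mul, map_mul, mul_assoc]
      _ = F (T (exp a * (d * x i))) := by rw [hd.x_mul, hT_mul, map_mul, map_mul]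
      _ = (F * T) (exp a * d) * (F * T) (x i) := by rw [← mul_assoc, map_mul, map_mul]; rfl

end IsConjugator

theorem isConjugator_expAlgEquiv [CharZero k] {u : Fin n → Ass k n} {i : Fin n}
    (hu : u i [] = 0) : IsConjugator (expAlgEquiv u) i (cocycle (u i) u) where
  nil := cocycle_nil _ _
  x_mul := by
    have htwist := raisesOrder_twist hu u
    have hmul : opExp (twist (u i) u) (1 * x i) = cocycle (u i) u * expAut u (x i) :=
      opExp_mul htwist (raisesOrder_der u) (fun f g => by
        simp only [twist_apply, der_mul]; noncomm_ring) 1 (x i)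
    have hcomm : x i * cocycle (u i) u = opExp (twist (u i) u) (x i * 1) :=
      map_opExp (S := LinearMap.mulLeft k (x i)) (raisesOrder_mulLeft (orderGE_zero _)) htwist
        htwist (fun f => by
          simp only [twist_apply, LinearMap.mulLeft_apply, der_x_mul]; noncomm_ring) 1
    rw [hcomm, expAlgEquiv_apply, ← hmul, mul_one, one_mul]

end Conjugator

/-! ### Lie series and tangential derivations -/

section Lie

variable {k : Type*} [Field k] {n m : ℕ}

theorem restr_const_of_mem_liePoly {a : Ass k n} (ha : a ∈ liePoly k n) (i : Fin n) :
    restr (fun _ : Fin 1 => i) a = a [i] • x 0 := by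
  rw [liePoly] at ha
  induction ha using LieSubalgebra.lieSpan_induction with
  | mem _ h =>
    obtain ⟨j, rfl⟩ := h
    ext w
    by_cases hj : i = j
    · rw [← hj, restr_x_of_injective (Function.injective_of_subsingleton fun _ : Fin 1 => i) 0]
      simp [x, word]
    · rw [restr_x_of_notMem (by simpa using Ne.symm hj)]
      simp [x, word, hj]
  | zero => rw [map_zero, zero_apply, zero_smul]
  | add a b _ _ iha ihb => rw [map_add, iha, ihb, add_apply, add_smul]
  | smul c a _ ih => rw [map_smul, ih, smul_apply, mul_smul]
  | lie a b _ _ _ _ =>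
    have hab : restr (fun _ : Fin 1 => i) ⁅a, b⁆ = 0 := by
      rw [LieRing.of_associative_ring_bracket, map_sub, map_mul, map_mul,
        (commute_of_one_variable _ _).eq, sub_self]
    have hcoeff : (⁅a, b⁆ : Ass k n) [i] = 0 := congrFun hab [0]
    rw [hab, hcoeff, zero_smul]

theorem restr_const_of_mem_lie {a : Ass k n} (ha : a ∈ lie k n) (i : Fin n) :
    restr (fun _ : Fin 1 => i) a = a [i] • x 0 := by
  ext w
  have h := congrFun (restr_const_of_mem_liePoly (ha w.length) i) w
  simp only [restr_apply, component, smul_apply, List.length_map, if_true,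
    List.length_singleton] at h
  rw [restr_apply, h, smul_apply]
  by_cases hw : w = [0] <;> simp [x, word, hw]

theorem lie_nil {a : Ass k n} (ha : a ∈ lie k n) (i : Fin n) : a [] = 0 := by
  simpa [restr_apply, x_nil] using congrFun (restr_const_of_mem_lie ha i) []

theorem single_nil {q : Ass k m} (hq : q [] = 0) (p i : Fin n) :
    (Pi.single p q : Fin n → Ass k m) i [] = 0 := by
  by_cases h : i = p
  · subst h; rwa [Pi.single_eq_same]
  · rw [Pi.single_eq_of_ne h, zero_apply]

theorem subst_single_eq_subst_restr {q : Ass k m} (hq : q [] = 0) (p : Fin n) (f : Ass k n) :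
    subst (Pi.single p q) f = subst (fun _ : Fin 1 => q) (restr (fun _ => p) f) := by
  refine DFunLike.congr_fun (algHom_ext (G := substHom _ (single_nil hq p))
    (H := (substHom (fun _ : Fin 1 => q) fun _ => hq).comp (restr fun _ => p)) fun i => ?_) f
  rw [AlgHom.comp_apply, substHom_apply, subst_x (single_nil hq p)]
  by_cases h : i = p
  · rw [h, restr_x_of_injective (Function.injective_of_subsingleton fun _ : Fin 1 => p) 0,
      substHom_apply, subst_x fun _ => hq, Pi.single_eq_same]
  · rw [restr_x_of_notMem (by simpa using h), map_zero, Pi.single_eq_of_ne h]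

theorem subst_single_of_mem_lie {a : Ass k n} (ha : a ∈ lie k n) {q : Ass k m} (hq : q [] = 0)
    (p : Fin n) : subst (Pi.single p q) a = a [p] • q := by
  rw [subst_single_eq_subst_restr hq, restr_const_of_mem_lie ha, map_smul, subst_x fun _ => hq]

theorem smul_x_mem_lie (c : k) (i : Fin n) : c • x i ∈ lie k n := by
  intro d
  have hcomp : component d (c • x i : Ass k n) = if d = 1 then c • x i else 0 := by
    ext w
    by_cases hw : w = [i]
    · subst hw; by_cases hd : d = 1 <;> simp [component, x, word, hd, eq_comm (a := 1)]
    · by_cases hd : d = 1 <;> simp [component, x, word, hd, hw]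
  rw [hcomp]
  split_ifs
  · exact (liePoly k n).smul_mem c (LieSubalgebra.subset_lieSpan ⟨i, rfl⟩)
  · exact (liePoly k n).zero_mem

theorem smul_t_mem_dert (c : k) : c • t k ∈ dert k 2 :=
  Fin.forall_fin_two.mpr
    ⟨⟨smul_x_mem_lie c 1, by simp [t, x, word]⟩, smul_x_mem_lie c 0, by simp [t, x, word]⟩

theorem dert_nil {u : Fin n → Ass k n} (hu : u ∈ dert k n) (i : Fin n) : u i [] = 0 :=
  lie_nil (hu i).1 i

theorem restr_const_of_mem_dert {u : Fin n → Ass k n} (hu : u ∈ dert k n) (i : Fin n) :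
    restr (fun _ : Fin 1 => i) (u i) = 0 := by
  rw [restr_const_of_mem_lie (hu i).1, (hu i).2, zero_smul]

theorem restr_const_der_of_mem_dert {u : Fin n → Ass k n} (hu : u ∈ dert k n) (i : Fin n)
    (f : Ass k n) : restr (fun _ : Fin 1 => i) (der u f) = 0 := by
  have hzero : (fun _ : Fin 1 => restr (fun _ : Fin 1 => i) (u i)) = 0 :=
    funext fun _ => restr_const_of_mem_dert hu i
  rw [restr_der (Function.injective_of_subsingleton _), hzero, der_zero, LinearMap.zero_apply]

theorem restr_const_cocycle {u : Fin n → Ass k n} (hu : u ∈ dert k n) (i : Fin n) :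
    restr (fun _ : Fin 1 => i) (cocycle (u i) u) = 1 := by
  rw [map_cocycle (v := 0) _ (fun j => ?_) (dert_nil hu i), restr_const_of_mem_dert hu,
    cocycle_zero_left]
  rw [restr_const_der_of_mem_dert hu, der_zero, LinearMap.zero_apply]

theorem restr_const_expAut [CharZero k] {u : Fin n → Ass k n} (hu : u ∈ dert k n) (i : Fin n)
    (f : Ass k n) : restr (fun _ : Fin 1 => i) (expAut u f) = restr (fun _ : Fin 1 => i) f := by
  rw [map_expAut (v := 0) _ (fun j => ?_), expAut_zero]
  rw [restr_const_der_of_mem_dert hu, der_zero, LinearMap.zero_apply]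

theorem cocycle_of_expAut_mul [CharZero k] {u v w : Fin n → Ass k n} (hu : u ∈ dert k n)
    (hv : v ∈ dert k n) (hw : w ∈ dert k n) (h : expAut w = expAut u * expAut v) (i : Fin n) :
    cocycle (w i) w = cocycle (u i) u * expAut u (cocycle (v i) v) := by
  have hmul : expAlgEquiv w = expAlgEquiv u * expAlgEquiv v :=
    AlgEquiv.ext fun f => LinearEquiv.congr_fun h f
  refine (isConjugator_expAlgEquiv (dert_nil hw i)).eq_of_restr_eq (hmul ▸
    (isConjugator_expAlgEquiv (dert_nil hu i)).mul (isConjugator_expAlgEquiv (dert_nil hv i))) ?_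
  rw [map_mul, restr_const_expAut hu, restr_const_cocycle hu,
    restr_const_cocycle hv, restr_const_cocycle hw, one_mul]

end Lie

/-! ### Cablings -/

section Cabling

variable {k : Type*} [Field k] {n m l : ℕ}

/-- The sum of the generators that the labelling `j` assigns to `p`. -/
noncomputable def strands (k : Type*) [Field k] (j : Fin m → Option (Fin n)) (p : Fin n) :
    Ass k m := ∑ i with j i = some p, x i

/-- The tuple obtained from `u` by substituting the sum of the generators labelled `p` for `x_p`,
with `u_p` at every place labelled `p` and `0` at the places labelled `none`. The labellings
`(0, 1, none)`, `(none, 0, 1)`, `(0, 0, 1)`, `(0, 1, 1)` give `u^{1,2}`, `u^{2,3}`, `u^{12,3}`,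
`u^{1,23}`. -/
noncomputable def cable (j : Fin m → Option (Fin n)) (u : Fin n → Ass k n) : Fin m → Ass k m :=
  fun i => (j i).elim 0 fun p => subst (strands k j) (u p)

theorem strands_nil (j : Fin m → Option (Fin n)) (p : Fin n) : strands k j p [] = 0 := by
  rw [strands, sum_apply, Finset.sum_eq_zero fun i _ => x_nil i]

theorem strands_some : strands k (some : Fin n → Option (Fin n)) = x :=
  funext fun p => by simp [strands, Finset.filter_eq']

theorem cable_some (u : Fin n → Ass k n) : cable some u = u :=
  funext fun i => by
    rw [cable, Option.elim_some, strands_some, subst_x_self]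

theorem cable_eq_subst {j : Fin m → Option (Fin n)} {i : Fin m} {p : Fin n} (h : j i = some p)
    (u : Fin n → Ass k n) : cable j u i = subst (strands k j) (u p) := by
  rw [cable, h, Option.elim_some]

theorem cable_eq_zero {j : Fin m → Option (Fin n)} {i : Fin m} (h : j i = none)
    (u : Fin n → Ass k n) : cable j u i = 0 := by
  rw [cable, h, Option.elim_none]

theorem cable_nil (j : Fin m → Option (Fin n)) {u : Fin n → Ass k n} (hu : ∀ p, u p [] = 0)
    (i : Fin m) : cable j u i [] = 0 := by
  rcases h : j i with - | p
  · rw [cable_eq_zero h, zero_apply]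
  · rw [cable_eq_subst h, ← substHom_apply (strands_nil j), algHom_nil, hu]

theorem subst_strands_der_x (j : Fin m → Option (Fin n)) (u : Fin n → Ass k n) (p : Fin n) :
    substHom (strands k j) (strands_nil j) (der u (x p))
      = der (cable j u) (substHom (strands k j) (strands_nil j) (x p)) := by
  simp only [der_x, map_sub, map_mul, substHom_apply, subst_x (strands_nil j)]
  rw [strands, map_sum, Finset.sum_mul, Finset.mul_sum, ← Finset.sum_sub_distrib]
  refine Finset.sum_congr rfl fun i hi => ?_
  rw [der_x, cable_eq_subst (Finset.mem_filter.mp hi).2]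

theorem restr_strands {ι : Fin l → Fin m} (hι : Function.Injective ι)
    (j : Fin m → Option (Fin n)) (p : Fin n) :
    restr ι (strands k j p) = strands k (j ∘ ι) p := by
  rw [strands, strands, map_sum]
  refine (Finset.sum_of_injOn ι hι.injOn (fun i hi => by simpa using hi) (fun i _ hi => ?_)
    fun i _ => (restr_x_of_injective hι i).symm).symm
  refine restr_x_of_notMem fun ⟨i', hi'⟩ => hi ⟨i', ?_, hi'⟩
  simp_all

theorem restr_subst_strands {ι : Fin l → Fin m} (hι : Function.Injective ι)
    (j : Fin m → Option (Fin n)) (f : Ass k n) :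
    restr ι (subst (strands k j) f) = subst (strands k (j ∘ ι)) f := by
  rw [map_subst _ (strands_nil j)]
  simp only [restr_strands hι]

theorem restr_cable {ι : Fin l → Fin m} (hι : Function.Injective ι) (j : Fin m → Option (Fin n))
    (u : Fin n → Ass k n) (i : Fin l) : restr ι (cable j u (ι i)) = cable (j ∘ ι) u i := by
  rcases h : j (ι i) with - | p
  · rw [cable_eq_zero h, cable_eq_zero (j := j ∘ ι) h, map_zero]
  · rw [cable_eq_subst h, cable_eq_subst (j := j ∘ ι) h, restr_subst_strands hι]

theorem subst_strands_cocycle (j : Fin m → Option (Fin n)) {u : Fin n → Ass k n} {p : Fin n}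
    (hu : u p [] = 0) {i : Fin m} (hi : j i = some p) :
    cocycle (cable j u i) (cable j u) = subst (strands k j) (cocycle (u p) u) := by
  rw [cable_eq_subst hi, ← substHom_apply (strands_nil j), ← substHom_apply (strands_nil j),
    map_cocycle _ (subst_strands_der_x j u) hu]

variable [CharZero k]

theorem subst_strands_expAut (j : Fin m → Option (Fin n)) (u : Fin n → Ass k n) (f : Ass k n) :
    subst (strands k j) (expAut u f) = expAut (cable j u) (subst (strands k j) f) :=
  map_expAut (substHom (strands k j) (strands_nil j)) (subst_strands_der_x j u) f

theorem restr_expAut_cable {ι : Fin l → Fin m} (hι : Function.Injective ι)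
    (j : Fin m → Option (Fin n)) (u : Fin n → Ass k n) (f : Ass k m) :
    restr ι (expAut (cable j u) f) = expAut (cable (j ∘ ι) u) (restr ι f) :=
  map_expAut _ (fun i => by
    rw [restr_der hι]; simp only [restr_cable hι]) f

theorem isConjugator_cable {j : Fin m → Option (Fin n)} {u : Fin n → Ass k n}
    (hu : ∀ p, u p [] = 0) {i : Fin m} {p : Fin n} (hi : j i = some p) :
    IsConjugator (expAlgEquiv (cable j u)) i (subst (strands k j) (cocycle (u p) u)) :=
  subst_strands_cocycle j (hu p) hi ▸ isConjugator_expAlgEquiv (cable_nil j hu i)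

theorem isConjugator_cable_of_none {j : Fin m → Option (Fin n)} {u : Fin n → Ass k n} {i : Fin m}
    (hi : j i = none) : IsConjugator (expAlgEquiv (cable j u)) i 1 := by
  have h := isConjugator_expAlgEquiv (u := cable j u) (i := i) (by
    rw [cable_eq_zero hi, zero_apply])
  rwa [cable_eq_zero hi, cocycle_zero_left] at h

/-- The conjugating series of `exp(u)` at `x_p` is multiplicative in `exp(u)` once it is normalized
to contain no powers of `x_p`, and it determines the cabled automorphism. -/
theorem expAut_cable_of_expAut_mul (j : Fin m → Option (Fin n)) {u v w : Fin n → Ass k n}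
    (hu : u ∈ dert k n) (hv : v ∈ dert k n) (hw : w ∈ dert k n)
    (h : expAut w = expAut u * expAut v) :
    expAut (cable j w) = expAut (cable j u) * expAut (cable j v) := by
  suffices expAlgEquiv (cable j w) = expAlgEquiv (cable j u) * expAlgEquiv (cable j v) from
    LinearEquiv.ext fun f => AlgEquiv.congr_fun this f
  refine algEquiv_ext fun i => ?_
  rcases hi : j i with - | p
  · have hmul := (isConjugator_cable_of_none (u := u) hi).mul
      (isConjugator_cable_of_none (u := v) hi)
    rw [map_one, mul_one] at hmul
    exact (isConjugator_cable_of_none hi).apply_x_eq hmul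
  · have hmul := (isConjugator_cable (dert_nil hu) hi).mul (isConjugator_cable (dert_nil hv) hi)
    rw [expAlgEquiv_apply, ← subst_strands_expAut, ← subst_mul (strands_nil j),
      ← cocycle_of_expAut_mul hu hv hw h] at hmul
    exact (isConjugator_cable (dert_nil hw) hi).apply_x_eq hmul

end Cabling

/-! ### Cablings with a single label -/

section SingleLabel

variable {k : Type*} [Field k] {n m l : ℕ} {j : Fin m → Option (Fin n)} {p : Fin n}

theorem strands_eq_single (hj : ∀ i q, j i = some q → q = p) :
    strands k j = Pi.single p (strands k j p) := by
  funext q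
  by_cases hq : q = p
  · rw [hq, Pi.single_eq_same]
  · rw [Pi.single_eq_of_ne hq, strands, Finset.sum_eq_zero]
    exact fun i hi => absurd (hj i q (Finset.mem_filter.mp hi).2) hq

theorem subst_single_cocycle {u : Fin n → Ass k n} (hu : u ∈ dert k n) {q : Ass k m}
    (hq : q [] = 0) (p i : Fin n) :
    subst (Pi.single p q) (cocycle (u i) u) = exp (u i [p] • q) := by
  have hder (i : Fin n) : substHom _ (single_nil hq p) (der u (x i))
      = der 0 (substHom _ (single_nil hq p) (x i)) := by
    rw [substHom_apply, subst_single_eq_subst_restr hq, restr_const_der_of_mem_dert hu,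
      ← substHom_apply fun _ => hq, map_zero, der_zero, LinearMap.zero_apply]
  rw [← substHom_apply (single_nil hq p), map_cocycle _ hder (dert_nil hu i), cocycle_zero_right,
    substHom_apply, subst_single_of_mem_lie (hu i).1 hq]

theorem subst_strands_cocycle_of_single_label {u : Fin n → Ass k n} (hu : u ∈ dert k n)
    (hj : ∀ i q, j i = some q → q = p) (i : Fin n) :
    subst (strands k j) (cocycle (u i) u) = exp (u i [p] • strands k j p) := by
  rw [strands_eq_single hj, subst_single_cocycle hu (strands_nil j p), Pi.single_eq_same]

theorem cable_eq_zero_of_single_label {u : Fin n → Ass k n} (hu : u ∈ dert k n)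
    (hj : ∀ i q, j i = some q → q = p) : cable j u = 0 := by
  funext i
  rcases hi : j i with - | q
  · exact cable_eq_zero hi u
  · rw [cable_eq_subst hi, hj i q hi, strands_eq_single hj,
      subst_single_of_mem_lie (hu p).1 (strands_nil j p), (hu p).2, zero_smul, Pi.zero_apply]

end SingleLabel

/-! ### The pentagon solution -/

section Pentagon

variable {k : Type*} [Field k]

theorem strands_1_2 :
    strands k (![some 0, some 1, none] : Fin 3 → Option (Fin 2)) = ![x 0, x 1] := by
  funext p; fin_cases p <;> simp [strands, Finset.sum_filter, Fin.sum_univ_three]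

theorem strands_2_3 :
    strands k (![none, some 0, some 1] : Fin 3 → Option (Fin 2)) = ![x 1, x 2] := by
  funext p; fin_cases p <;> simp [strands, Finset.sum_filter, Fin.sum_univ_three]

theorem strands_12_3 :
    strands k (![some 0, some 0, some 1] : Fin 3 → Option (Fin 2)) = ![x 0 + x 1, x 2] := by
  funext p; fin_cases p <;> simp [strands, Finset.sum_filter, Fin.sum_univ_three]

theorem strands_1_23 :
    strands k (![some 0, some 1, some 1] : Fin 3 → Option (Fin 2)) = ![x 0, x 1 + x 2] := by
  funext p; fin_cases p <;> simp [strands, Finset.sum_filter, Fin.sum_univ_three]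

variable (u : Fin 2 → Ass k 2)

theorem map_1_2_eq_cable : map_1_2 u = cable ![some 0, some 1, none] u := by
  funext i; fin_cases i <;> simp [map_1_2, cable, strands_1_2]

theorem map_2_3_eq_cable : map_2_3 u = cable ![none, some 0, some 1] u := by
  funext i; fin_cases i <;> simp [map_2_3, cable, strands_2_3]

theorem map_12_3_eq_cable : map_12_3 u = cable ![some 0, some 0, some 1] u := by
  funext i; fin_cases i <;> simp [map_12_3, cable, strands_12_3]

theorem map_1_23_eq_cable : map_1_23 u = cable ![some 0, some 1, some 1] u := by
  funext i; fin_cases i <;> simp [map_1_23, cable, strands_1_23]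

theorem x_mul_smul_t_sub (c : k) (i : Fin 2) :
    x i * (c • t k) i - (c • t k) i * x i
      = x i * (c • (x 0 + x 1)) - (c • (x 0 + x 1)) * x i := by
  fin_cases i <;> simp [t, mul_add, add_mul]

variable [CharZero k]

/-- `Φ_F` for `F = exp(u)`, as an automorphism of the algebra of series. -/
noncomputable def pentagonAlgEquiv (u : Fin 2 → Ass k 2) : Ass k 3 ≃ₐ[k] Ass k 3 :=
  (expAlgEquiv (map_12_3 u))⁻¹ * (expAlgEquiv (map_1_2 u))⁻¹ * expAlgEquiv (map_2_3 u)
    * expAlgEquiv (map_1_23 u)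

theorem expAlgEquiv_mul_pentagonAlgEquiv :
    expAlgEquiv (map_1_2 u) * expAlgEquiv (map_12_3 u) * pentagonAlgEquiv u
      = expAlgEquiv (map_2_3 u) * expAlgEquiv (map_1_23 u) := by
  rw [pentagonAlgEquiv]; group

variable {u}

theorem exists_isConjugator_pentagonAlgEquiv (hu : ∀ p, u p [] = 0) (i : Fin 3) :
    ∃ c, IsConjugator (pentagonAlgEquiv u) i c := by
  have hcable (j : Fin 3 → Option (Fin 2)) :
      IsConjugator (expAlgEquiv (cable j u)) i (cocycle (cable j u i) (cable j u)) :=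
    isConjugator_expAlgEquiv (cable_nil j hu i)
  rw [pentagonAlgEquiv, map_12_3_eq_cable, map_1_2_eq_cable, map_2_3_eq_cable, map_1_23_eq_cable]
  obtain ⟨c, hc⟩ := (hcable ![some 0, some 0, some 1]).exists_inv
  obtain ⟨d, hd⟩ := (hcable ![some 0, some 1, none]).exists_inv
  exact ⟨_, ((hc.mul hd).mul (hcable _)).mul (hcable _)⟩

theorem isConjugator_exp_smul_x_mul_cocycle {n : ℕ} {u : Fin n → Ass k n} {i : Fin n}
    (hu : u i [] = 0) (c : k) :
    IsConjugator (expAlgEquiv u) i (exp (c • x i) * cocycle (u i) u) :=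
  (isConjugator_expAlgEquiv hu).mul_left_of_commute (exp_nil _)
    (commute_exp_left (by rw [smul_apply, x_nil, mul_zero]) ((Commute.refl _).smul_left c))

/-- Compare the conjugators at `x` of the two sides of `F^{1,2} F^{12,3} = F^{2,3} F^{1,23} Φ⁻¹` and
set `x = 0`; then `F^{1,2}` and `F^{1,23}` become trivial, `F^{12,3}` and `F^{2,3}` become `F`. -/
theorem isConjugator_zero_of_pentagonAlgEquiv (hu : u ∈ dert k 2) {d : Ass k 3}
    (hd : IsConjugator (pentagonAlgEquiv u)⁻¹ 0 d) :
    IsConjugator (expAlgEquiv u) 0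
      (expAlgEquiv u (exp (u 0 [1] • (x 0 + x 1)) * restr Fin.succ d)) := by
  have hnil := dert_nil hu
  have hsucc : Function.Injective (Fin.succ : Fin 2 → Fin 3) := Fin.succ_injective 2
  have hΦ := eq_mul_inv_of_mul_eq (expAlgEquiv_mul_pentagonAlgEquiv u)
  rw [map_12_3_eq_cable, map_1_2_eq_cable, map_2_3_eq_cable, map_1_23_eq_cable] at hΦ
  have hleft := (isConjugator_cable (i := 0) (j := ![some 0, some 1, none]) hnil rfl).mul
    (isConjugator_cable (j := ![some 0, some 0, some 1]) hnil rfl)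
  have hright := ((isConjugator_cable_of_none (u := u) (i := 0) (j := ![none, some 0, some 1])
    rfl).mul (isConjugator_cable (j := ![some 0, some 1, some 1]) hnil rfl)).mul hd
  have h := (hΦ ▸ hleft).restr_eq (ι := Fin.succ) (by simp) hright
  simp only [map_mul, AlgEquiv.mul_apply, expAlgEquiv_apply, restr_expAut_cable hsucc,
    restr_subst_strands hsucc, one_mul] at h
  have h12 : (![some 0, some 1, none] : Fin 3 → Option (Fin 2)) ∘ Fin.succ = ![some 1, none] := rfl
  have h23 : (![none, some 0, some 1] : Fin 3 → Option (Fin 2)) ∘ Fin.succ = some := by decide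
  have h12_3 : (![some 0, some 0, some 1] : Fin 3 → Option (Fin 2)) ∘ Fin.succ = some := by decide
  have h1_23 : (![some 0, some 1, some 1] : Fin 3 → Option (Fin 2)) ∘ Fin.succ
      = ![some 1, some 1] := rfl
  rw [h12, h23, h12_3, h1_23, cable_some, strands_some, subst_x_self,
    cable_eq_zero_of_single_label (p := 1) hu (by decide),
    cable_eq_zero_of_single_label (p := 1) hu (by decide),
    subst_strands_cocycle_of_single_label (p := 1) hu (by decide),
    subst_strands_cocycle_of_single_label (p := 1) hu (by decide), expAut_zero, expAut_zero,
    ← expAlgEquiv_apply, ← expAlgEquiv_apply, ← map_mul] at h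
  have hx : strands k ![(some 1 : Option (Fin 2)), none] 1 = x 0 := by
    simp [strands, Finset.sum_filter]
  have hsum : strands k ![(some 1 : Option (Fin 2)), some 1] 1 = x 0 + x 1 := by
    simp [strands, Finset.sum_filter]
  rw [hx, hsum] at h
  exact h ▸ isConjugator_exp_smul_x_mul_cocycle (hnil 0) (u 0 [1])

/-- Compare the conjugators at `z` of the two sides of `F^{1,2} F^{12,3} Φ = F^{2,3} F^{1,23}` and
set `z = 0`. -/
theorem isConjugator_one_of_pentagonAlgEquiv (hu : u ∈ dert k 2) {d : Ass k 3}
    (hd : IsConjugator (pentagonAlgEquiv u) 2 d) :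
    IsConjugator (expAlgEquiv u) 1
      (expAlgEquiv u (exp (u 1 [0] • (x 0 + x 1)) * restr Fin.castSucc d)) := by
  have hnil := dert_nil hu
  have hcast : Function.Injective (Fin.castSucc : Fin 2 → Fin 3) := Fin.castSucc_injective 2
  have hΦ := expAlgEquiv_mul_pentagonAlgEquiv u
  rw [map_12_3_eq_cable, map_1_2_eq_cable, map_2_3_eq_cable, map_1_23_eq_cable] at hΦ
  have hleft := ((isConjugator_cable_of_none (u := u) (i := 2) (j := ![some 0, some 1, none])
    rfl).mul (isConjugator_cable (j := ![some 0, some 0, some 1]) hnil rfl)).mul hd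
  have hright := (isConjugator_cable (i := 2) (j := ![none, some 0, some 1]) hnil rfl).mul
    (isConjugator_cable (j := ![some 0, some 1, some 1]) hnil rfl)
  have h := (hΦ ▸ hleft).restr_eq (ι := Fin.castSucc) (by decide) hright
  simp only [map_mul, AlgEquiv.mul_apply, expAlgEquiv_apply, restr_expAut_cable hcast,
    restr_subst_strands hcast, one_mul] at h
  have h12 : (![some 0, some 1, none] : Fin 3 → Option (Fin 2)) ∘ Fin.castSucc = some := by decide
  have h23 : (![none, some 0, some 1] : Fin 3 → Option (Fin 2)) ∘ Fin.castSucc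
      = ![none, some 0] := by decide
  have h12_3 : (![some 0, some 0, some 1] : Fin 3 → Option (Fin 2)) ∘ Fin.castSucc
      = ![some 0, some 0] := by decide
  have h1_23 : (![some 0, some 1, some 1] : Fin 3 → Option (Fin 2)) ∘ Fin.castSucc = some := by
    decide
  rw [h12, h23, h12_3, h1_23, cable_some, strands_some, subst_x_self,
    cable_eq_zero_of_single_label (p := 0) hu (by decide),
    cable_eq_zero_of_single_label (p := 0) hu (by decide),
    subst_strands_cocycle_of_single_label (p := 0) hu (by decide),
    subst_strands_cocycle_of_single_label (p := 0) hu (by decide), expAut_zero, expAut_zero,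
    ← expAlgEquiv_apply, ← expAlgEquiv_apply, ← map_mul] at h
  have hx : strands k ![none, (some 0 : Option (Fin 2))] 0 = x 1 := by
    simp [strands, Finset.sum_filter]
  have hsum : strands k ![(some 0 : Option (Fin 2)), some 0] 0 = x 0 + x 1 := by
    simp [strands, Finset.sum_filter]
  rw [hx, hsum] at h
  exact h ▸ isConjugator_exp_smul_x_mul_cocycle (hnil 1) (u 1 [0])

theorem expAut_sum_apply (u : Fin 2 → Ass k 2) :
    (expAut u (x 0 + x 1)) [0, 1] = u 0 [1] - u 1 [0] := by
  have hder2 : (der u (der u (x 0 + x 1))) [0, 1] = 0 :=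
    orderGE_der u (orderGE_der u ((orderGE_x 0).add (orderGE_x 1))) _ (by simp)
  have hder : (der u (x 0 + x 1)) [0, 1] = u 0 [1] - u 1 [0] := by
    have hright (i : Fin 2) : (u i * x i : Ass k 2) [0, 1] = if 1 = i then u i [0] else 0 :=
      mul_x_append i 1 (u i) [0]
    simp [der_x, x_mul_cons, hright, sub_eq_add_neg]
  have hx : (x 0 + x 1 : Ass k 2) [0, 1] = 0 := by simp [x, word]
  have h := (raisesOrder_der u).orderGE_opExp_sub_sum (x 0 + x 1) 3 [0, 1] (by simp)
  rw [← expAut_eq_opExp, sub_apply, sub_eq_zero] at h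
  rw [h]
  simp [Finset.sum_range_succ, pow_two, Module.End.mul_apply, hder2, hder, hx, -map_add]

theorem expAlgEquiv_smul_t_apply (c : k) (f : Ass k 2) :
    expAlgEquiv (c • t k) f = exp (-(c • (x 0 + x 1))) * f * exp (c • (x 0 + x 1)) :=
  expAut_eq_conj (by simp [x_nil]) (x_mul_smul_t_sub c) f

theorem exists_eq_mul_of_pentagonSol_eq {u₁ u₂ : Fin 2 → Ass k 2} (h₁ : u₁ ∈ dert k 2)
    (h₂ : u₂ ∈ dert k 2) (hsum : expAut u₁ (x 0 + x 1) = expAut u₂ (x 0 + x 1))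
    (h : pentagonSol u₁ = pentagonSol u₂) :
    ∃ c : k, expAut u₂ = expAut u₁ * expAut (c • t k) := by
  have hΦ : pentagonAlgEquiv u₁ = pentagonAlgEquiv u₂ := AlgEquiv.ext (LinearEquiv.congr_fun h)
  have hnil : (x 0 + x 1 : Ass k 2) [] = 0 := by simp [x_nil]
  obtain ⟨c, hc0, hc1⟩ : ∃ c, c + u₁ 0 [1] = u₂ 0 [1] ∧ c + u₁ 1 [0] = u₂ 1 [0] := by
    have hcoeff := congrFun hsum [0, 1]
    rw [expAut_sum_apply, expAut_sum_apply] at hcoeff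
    exact ⟨u₂ 0 [1] - u₁ 0 [1], sub_add_cancel _ _, by linear_combination -hcoeff⟩
  obtain ⟨d, hd⟩ := exists_isConjugator_pentagonAlgEquiv (dert_nil h₁) 0
  obtain ⟨a, ha⟩ := hd.exists_inv
  obtain ⟨b, hb⟩ := exists_isConjugator_pentagonAlgEquiv (dert_nil h₁) 2
  have hcnil : (c • (x 0 + x 1) : Ass k 2) [] = 0 := by rw [smul_apply, hnil, mul_zero]
  have h0 := (isConjugator_zero_of_pentagonAlgEquiv h₁ ha).mul_inner hcnil
    (expAlgEquiv_smul_t_apply c)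
  have h1 := (isConjugator_one_of_pentagonAlgEquiv h₁ hb).mul_inner hcnil
    (expAlgEquiv_smul_t_apply c)
  rw [← mul_assoc, exp_smul_mul_exp_smul _ _ hnil, hc0] at h0
  rw [← mul_assoc, exp_smul_mul_exp_smul _ _ hnil, hc1] at h1
  have hmul : (expAlgEquiv u₂).symm = (expAlgEquiv u₁ * expAlgEquiv (c • t k)).symm :=
    algEquiv_ext fun i => by
      fin_cases i
      · exact (isConjugator_zero_of_pentagonAlgEquiv h₂ (hΦ ▸ ha)).symm_apply_x_eq h0
      · exact (isConjugator_one_of_pentagonAlgEquiv h₂ (hΦ ▸ hb)).symm_apply_x_eq h1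
  exact ⟨c, LinearEquiv.ext (AlgEquiv.congr_fun (AlgEquiv.symm_bijective.1 hmul))⟩

end Pentagon

/-! ### The one-parameter group of `t` -/

section Central

variable {k : Type*} [Field k] {n m : ℕ}

theorem der_subst_of_der_eq_zero {u : Fin m → Ass k m} {b : Fin n → Ass k m}
    (hb : ∀ i, b i [] = 0) (h : ∀ i, der u (b i) = 0) (f : Ass k n) : der u (subst b f) = 0 := by
  have hder := map_der (substHom b hb) (u := 0) (v := u) (fun i => by
    rw [der_zero, LinearMap.zero_apply, map_zero, substHom_apply, subst_x hb, h]) f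
  rw [der_zero, LinearMap.zero_apply, map_zero] at hder
  exact hder.symm

theorem x_add_x_nil (i j : Fin n) : (x i + x j : Ass k n) [] = 0 := by
  rw [add_apply, x_nil, x_nil, add_zero]

theorem der_smul_t_apply (c : k) (f : Ass k 2) :
    der (c • t k) f = f * (c • (x 0 + x 1)) - (c • (x 0 + x 1)) * f :=
  der_eq_inner (x_mul_smul_t_sub c) f

theorem map_1_2_smul_t (c : k) : map_1_2 (c • t k) = ![c • x 1, c • x 0, 0] := by
  simp [map_1_2, t, subst_x (pair_nil (x_nil 0) (x_nil 1))]

theorem map_2_3_smul_t (c : k) : map_2_3 (c • t k) = ![0, c • x 2, c • x 1] := by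
  simp [map_2_3, t, subst_x (pair_nil (x_nil 1) (x_nil 2))]

theorem map_12_3_smul_t (c : k) :
    map_12_3 (c • t k) = ![c • x 2, c • x 2, c • (x 0 + x 1)] := by
  simp [map_12_3, t, subst_x (pair_nil (x_add_x_nil 0 1) (x_nil 2))]

theorem map_1_23_smul_t (c : k) :
    map_1_23 (c • t k) = ![c • (x 1 + x 2), c • x 0, c • x 0] := by
  simp [map_1_23, t, subst_x (pair_nil (x_nil 0) (x_add_x_nil 1 2))]

theorem commute_der_map_1_2_map_12_3 (u : Fin 2 → Ass k 2) (c : k) :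
    Commute (der (map_1_2 (c • t k))) (der (map_12_3 u)) := by
  rw [map_1_2_smul_t]
  have hgen (p : Fin 2) : der ![c • x 1, c • x 0, 0]
      ((![x 0 + x 1, x 2] : Fin 2 → Ass k 3) p) = 0 := by
    fin_cases p <;> simp [der_x]
  have hsubst := der_subst_of_der_eq_zero (pair_nil (x_add_x_nil 0 1) (x_nil 2)) hgen
  refine commute_der (fun i => ?_) fun i => ?_
  · fin_cases i <;> exact hsubst _
  · fin_cases i <;> simp [map_12_3, der_x, smul_sub]

theorem commute_der_map_2_3_map_1_23 (u : Fin 2 → Ass k 2) (c : k) :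
    Commute (der (map_2_3 (c • t k))) (der (map_1_23 u)) := by
  rw [map_2_3_smul_t]
  have hgen (p : Fin 2) : der ![0, c • x 2, c • x 1]
      ((![x 0, x 1 + x 2] : Fin 2 → Ass k 3) p) = 0 := by
    fin_cases p <;> simp [der_x]
  have hsubst := der_subst_of_der_eq_zero (pair_nil (x_nil 0) (x_add_x_nil 1 2)) hgen
  refine commute_der (fun i => ?_) fun i => ?_
  · fin_cases i <;> exact hsubst _
  · fin_cases i <;> simp [map_1_23, der_x, smul_sub]

theorem map_1_2_add_map_12_3_smul_t (c : k) :
    map_1_2 (c • t k) + map_12_3 (c • t k) = map_2_3 (c • t k) + map_1_23 (c • t k) := by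
  rw [map_1_2_smul_t, map_2_3_smul_t, map_12_3_smul_t, map_1_23_smul_t]
  funext i; fin_cases i <;> simp [add_comm]

theorem der_map_1_2_add_map_12_3_smul_t (c : k) (f : Ass k 3) :
    der (map_1_2 (c • t k) + map_12_3 (c • t k)) f
      = f * (c • (x 0 + x 1 + x 2)) - (c • (x 0 + x 1 + x 2)) * f := by
  refine der_eq_inner (fun i => ?_) f
  rw [map_1_2_smul_t, map_12_3_smul_t]
  fin_cases i <;> simp [mul_add, add_mul] <;> abel

theorem pentagon_group_identity {G : Type*} [Group G] {A B C D S₁ S₂ S₃ S₄ : G}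
    (hA : Commute S₁ A) (hD : Commute S₃ D) (hS : S₁ * S₂ = S₃ * S₄)
    (h : Commute (A⁻¹ * B⁻¹ * C * D) (S₁ * S₂)) :
    (A * S₂)⁻¹ * (B * S₁)⁻¹ * (C * S₃) * (D * S₄) = A⁻¹ * B⁻¹ * C * D :=
  calc
    _ = S₂⁻¹ * (S₁ * A)⁻¹ * B⁻¹ * C * (S₃ * D) * S₄ := by simp only [mul_inv_rev, mul_assoc]
    _ = (S₁ * S₂)⁻¹ * (A⁻¹ * B⁻¹ * C * D * (S₃ * S₄)) := by
      rw [hA.eq, hD.eq]; simp only [mul_inv_rev, mul_assoc]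
    _ = A⁻¹ * B⁻¹ * C * D := by rw [← hS, h.eq, inv_mul_cancel_left]

variable [CharZero k]

theorem smul_t_mem_hkv (c : k) : c • t k ∈ hkv k := by
  refine ⟨smul_t_mem_dert c, ?_, ?_⟩
  · rw [der_smul_t_apply, mul_smul_comm, smul_mul_assoc, sub_self]
  · have h (i : Fin 2) : partialD i ((c • t k) i) = 0 := by
      ext w; fin_cases i <;> cases w <;> simp [partialD, t, x, word]
    simp only [div, divAss, h, mul_zero, Finset.sum_const_zero, map_zero, Submodule.zero_mem]

theorem commute_expAut_smul_t {u : Fin 2 → Ass k 2} (hu : der u (x 0 + x 1) = 0) (c : k) :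
    Commute (expAut (c • t k)) (expAut u) := by
  refine commute_expAut (LinearMap.ext fun f => ?_)
  have hsmul : der u (c • (x 0 + x 1)) = 0 := by rw [map_smul, hu, smul_zero]
  simp only [Module.End.mul_apply, der_smul_t_apply, map_sub, der_mul, hsmul, mul_zero, zero_mul,
    add_zero, zero_add]

variable {u : Fin 2 → Ass k 2}

theorem expAut_cable_strands_sum (hu : expAut u (x 0 + x 1) = ch k)
    (j : Fin m → Option (Fin 2)) :
    expAut (cable j u) (strands k j 0 + strands k j 1) = subst (strands k j) (ch k) := by
  rw [← hu, subst_strands_expAut, ← substHom_apply (strands_nil j), map_add (substHom _ _),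
    substHom_apply, substHom_apply, subst_x (strands_nil j), subst_x (strands_nil j)]

theorem expAut_subst_ch (v : Fin n → Ass k n) {a b : Ass k n} (ha : a [] = 0) (hb : b [] = 0) :
    expAut v (subst ![a, b] (ch k)) = subst ![expAut v a, expAut v b] (ch k) := by
  refine (map_subst (expAlgEquiv v).toAlgHom (pair_nil ha hb) _).trans (congrArg (subst · _) ?_)
  funext i; fin_cases i <;> rfl

theorem pentagonSol_sum (hu : expAut u (x 0 + x 1) = ch k) :
    pentagonSol u (x 0 + x 1 + x 2) = x 0 + x 1 + x 2 := by
  have hsum (j) := expAut_cable_strands_sum (m := 3) hu j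
  have h12 := hsum ![some 0, some 1, none]
  have h23 := hsum ![none, some 0, some 1]
  have h12_3 := hsum ![some 0, some 0, some 1]
  have h1_23 := hsum ![some 0, some 1, some 1]
  rw [← map_1_2_eq_cable, strands_1_2] at h12
  rw [← map_2_3_eq_cable, strands_2_3] at h23
  rw [← map_12_3_eq_cable, strands_12_3] at h12_3
  rw [← map_1_23_eq_cable, strands_1_23] at h1_23
  simp only [Matrix.cons_val_zero, Matrix.cons_val_one] at h12 h23 h12_3 h1_23
  have h2 : expAut (map_1_2 u) (x 2) = x 2 := expAut_of_der_eq_zero (by simp [der_x, map_1_2])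
  have h0 : expAut (map_2_3 u) (x 0) = x 0 := expAut_of_der_eq_zero (by simp [der_x, map_2_3])
  apply (expAut (map_1_2 u) * expAut (map_12_3 u)).injective
  calc
    expAut (map_1_2 u) (expAut (map_12_3 u) (pentagonSol u (x 0 + x 1 + x 2)))
      = expAut (map_2_3 u) (expAut (map_1_23 u) (x 0 + x 1 + x 2)) :=
        AlgEquiv.congr_fun (expAlgEquiv_mul_pentagonAlgEquiv u) _
    _ = subst ![x 0, subst ![x 1, x 2] (ch k)] (ch k) := by
      rw [add_assoc, h1_23, expAut_subst_ch _ (x_nil 0) (x_add_x_nil 1 2), h0, h23]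
    _ = subst ![subst ![x 0, x 1] (ch k), x 2] (ch k) :=
      (ch_assoc (x_nil 0) (x_nil 1) (x_nil 2)).symm
    _ = expAut (map_1_2 u) (expAut (map_12_3 u) (x 0 + x 1 + x 2)) := by
      rw [h12_3, expAut_subst_ch _ (x_add_x_nil 0 1) (x_nil 2), h12, h2]

theorem commute_pentagonSol (hu : expAut u (x 0 + x 1) = ch k) (c : k) :
    Commute (pentagonSol u) (expAut (map_1_2 (c • t k) + map_12_3 (c • t k))) := by
  have hsum : pentagonAlgEquiv u (x 0 + x 1 + x 2) = x 0 + x 1 + x 2 := pentagonSol_sum hu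
  refine LinearEquiv.ext fun f => map_expAut (pentagonAlgEquiv u).toAlgHom (fun i => ?_) f
  change pentagonAlgEquiv u _ = der _ (pentagonAlgEquiv u _)
  rw [der_map_1_2_add_map_12_3_smul_t, der_map_1_2_add_map_12_3_smul_t, map_sub, map_mul, map_mul,
    map_smul, hsum]

theorem pentagonSol_eq_of_eq_mul {u₁ u₂ : Fin 2 → Ass k 2} (h₁ : u₁ ∈ dert k 2)
    (h₂ : u₂ ∈ dert k 2) (hch : expAut u₁ (x 0 + x 1) = ch k) {c : k}
    (h : expAut u₂ = expAut u₁ * expAut (c • t k)) : pentagonSol u₁ = pentagonSol u₂ := by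
  have hcable (j : Fin 3 → Option (Fin 2)) :=
    expAut_cable_of_expAut_mul j h₁ (smul_t_mem_dert c) h₂ h
  have hsum := map_1_2_add_map_12_3_smul_t c
  have hcomm := commute_pentagonSol hch c
  have hleft := commute_der_map_1_2_map_12_3 (c • t k) c
  have hright := commute_der_map_2_3_map_1_23 (c • t k) c
  have hexp := congrArg expAut hsum
  rw [expAut_add_of_commute hleft] at hcomm hexp
  rw [expAut_add_of_commute hright] at hexp
  have hgroup := pentagon_group_identity (commute_expAut (commute_der_map_1_2_map_12_3 u₁ c))
    (commute_expAut (commute_der_map_2_3_map_1_23 u₁ c)) hexp hcomm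
  simp only [map_12_3_eq_cable, map_1_2_eq_cable, map_2_3_eq_cable, map_1_23_eq_cable] at hgroup
  rw [pentagonSol, pentagonSol]
  simp only [map_12_3_eq_cable, map_1_2_eq_cable, map_2_3_eq_cable, map_1_23_eq_cable, hcable]
  exact hgroup.symm

end Central

end Ass

theorem mainTheorem12_general {k : Type*} [Field k] [CharZero k] :
    (∀ u₁ ∈ Ass.dert k 2, ∀ u₂ ∈ Ass.dert k 2, Ass.expAut u₁ (Ass.x 0 + Ass.x 1) = Ass.ch k →
      Ass.expAut u₂ (Ass.x 0 + Ass.x 1) = Ass.ch k →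
        (Ass.pentagonSol u₁ = Ass.pentagonSol u₂ ↔
          ∃ c : k, Ass.expAut u₂ = Ass.expAut u₁ * Ass.expAut (c • Ass.t k))) ∧
    (∀ c : k, c • Ass.t k ∈ Ass.hkv k ∧
      ∀ u : Fin 2 → Ass k 2, Ass.der u (Ass.x 0 + Ass.x 1) = 0 →
        Commute (Ass.expAut (c • Ass.t k)) (Ass.expAut u)) := by
  refine ⟨fun u₁ h₁ u₂ h₂ hch₁ hch₂ => ⟨fun h => ?_, fun ⟨c, h⟩ => ?_⟩,
    fun c => ⟨?_, fun u hu => ?_⟩⟩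
  · exact Ass.exists_eq_mul_of_pentagonSol_eq h₁ h₂ (hch₁.trans hch₂.symm) h
  · exact Ass.pentagonSol_eq_of_eq_mul h₁ h₂ hch₁ h
  · exact Ass.smul_t_mem_hkv c
  · exact Ass.commute_expAut_smul_t hu c

theorem mainTheorem12 {k : Type*} [Field k] [CharZero k] :
    (∀ u₁ ∈ Ass.SolHKV k, ∀ u₂ ∈ Ass.SolHKV k,
      (Ass.pentagonSol u₁ = Ass.pentagonSol u₂ ↔
        ∃ c : k, Ass.expAut u₂ = Ass.expAut u₁ * Ass.expAut (c • Ass.t k))) ∧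
    (∀ c : k, c • Ass.t k ∈ Ass.hkv k ∧
      ∀ u ∈ Ass.hkv k, Commute (Ass.expAut (c • Ass.t k)) (Ass.expAut u)) := by
  obtain ⟨hpentagon, hcentral⟩ := mainTheorem12_general (k := k)
  exact ⟨fun u₁ h₁ u₂ h₂ => hpentagon u₁ h₁.1 u₂ h₂.1 h₁.2.1 h₂.2.1,
    fun c => ⟨(hcentral c).1, fun u hu => (hcentral c).2 u hu.2.1⟩⟩
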